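/- Let $n\ge 1$, $d>0$, let $\Omega$ be the open ball of $\mathbb R^n$ of radius $d/2$ centred at $0$, and let $r\in[0,d]$. Let $L^2_r(\Omega)$ be the set of $u\in L^2(\Omega)$ for which there is $\tilde u\in L^2(]0,d/2[)$ with $u(x)=\tilde u(\|x\|)$ for a.e. $x\in\Omega$. Assume $f,g\in L^2_r(\Omega)$, $f\ge 0$ and $g\ge 0$ a.e. in $\Omega$, and $a\in W^{1,\infty}(\mathbb R)$ (identified with its continuous representative) with $\inf_{\mathbb R}a>0$. For $u\in L^2(\Omega)$ and $x\in\Omega$ put $$l_r(u)(x)=\int_{\Omega\cap B(x,r)}g(y)u(y)\,dy,$$ where $B(x,r)$ is the closed ball, and consider the problem $$(P_r)\qquad -\operatorname{div}\big(a(l_r(u))\nabla u\big)=f\ \text{ in }\Omega,\qquad u\in H^1_0(\Omega),$$ in the weak sense: $\int_\Omega a(l_r(u))\nabla u\cdot\nabla v\,dx=\int_\Omega fv\,dx$ for all $v\in H^1_0(\Omega)$. Let $\varphi\in H^1_0(\Omega)$ be the weak solution of $-\Delta\varphi=f$ in $\Omega$, and let $I_r=[\inf_\Omega l_r(\varphi),\sup_\Omega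 l_r(\varphi)]$. **Proposition 3.4.** Let $n_1\ge 1$ be an odd integer and let $0=m_0<m_1<\dots<m_{n_1}$ be real numbers such that $$a(m_i)=\max_{[m_i,m_{i+1}]}a,\qquad a(m_{i+1})=\min_{[m_i,m_{i+1}]}a\qquad\text{for all } i\in\{0,2,\dots,n_1-1\},$$ $$I_r\subset\bigcap_{i\in\{0,2,\dots,n_1-1\}}[m_ia(m_i),\,m_{i+1}a(m_{i+1})].$$ Then $(P_r)$ has at least $\frac{n_1+1}{2}$ radial solutions: there are pairwise distinct solutions $u_i\in L^2_r(\Omega)$ of $(P_r)$, $i\in\{0,2,\dots,n_1-1\}$, such that $m_i\le l_r(u_i)(x)\le m_{i+1}$ for all $x\in\Omega$. -/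

import Mathlib

open MeasureTheory Metric Set
open scoped ContDiff ENNReal

namespace NonlocalRadial

/-- `ψ ∈ C_c^∞(Ω)`. -/
structure IsTestFunction {E : Type*} [NormedAddCommGroup E] [NormedSpace ℝ E]
    (Ω : Set E) (ψ : E → ℝ) : Prop where
  smooth : ContDiff ℝ ∞ ψ
  compact : HasCompactSupport ψ
  support_subset : tsupport ψ ⊆ Ω

/-- `G` is the weak (distributional) gradient of `u` on `Ω ⊆ ℝⁿ`. -/
def HasWeakGradient {n : ℕ} (Ω : Set (EuclideanSpace ℝ (Fin n)))
    (u : EuclideanSpace ℝ (Fin n) → ℝ)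
    (G : EuclideanSpace ℝ (Fin n) → EuclideanSpace ℝ (Fin n)) : Prop :=
  ∀ ψ, IsTestFunction Ω ψ → ∀ i : Fin n,
    ∫ x in Ω, u x * (gradient ψ x) i = - ∫ x in Ω, (G x) i * ψ x

/-- `u ∈ H¹₀(Ω)` with weak gradient `G`: `u` and `G` are square integrable, `G` is the weak
gradient of `u`, and `u` lies in the closure of `C_c^∞(Ω)` for the `H¹` norm. -/
structure MemH01 {n : ℕ} (Ω : Set (EuclideanSpace ℝ (Fin n)))
    (u : EuclideanSpace ℝ (Fin n) → ℝ)
    (G : EuclideanSpace ℝ (Fin n) → EuclideanSpace ℝ (Fin n)) : Prop where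
  memLp : MemLp u 2 (volume.restrict Ω)
  memLp_grad : MemLp G 2 (volume.restrict Ω)
  weakGradient : HasWeakGradient Ω u G
  approx : ∀ ε : ℝ≥0∞, 0 < ε → ∃ ψ, IsTestFunction Ω ψ ∧
    eLpNorm (fun x => u x - ψ x) 2 (volume.restrict Ω) < ε ∧
    eLpNorm (fun x => G x - gradient ψ x) 2 (volume.restrict Ω) < ε

/-- `u ∈ H¹₀(Ω)` is a weak solution of `-div (A ∇u) = f` in `Ω`, i.e.
`∫_Ω A ∇u · ∇v = ∫_Ω f v` for all `v ∈ H¹₀(Ω)`. -/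
def IsWeakSolution {n : ℕ} (Ω : Set (EuclideanSpace ℝ (Fin n)))
    (A f u : EuclideanSpace ℝ (Fin n) → ℝ) : Prop :=
  ∃ G, MemH01 Ω u G ∧ ∀ v H, MemH01 Ω v H →
    ∫ x in Ω, A x * inner ℝ (G x) (H x) = ∫ x in Ω, f x * v x

/-- The nonlocal functional `l_r(u)(x) = ∫_{Ω ∩ B(x,r)} g u`, with `B(x,r)` the closed ball. -/
noncomputable def lr {n : ℕ} (Ω : Set (EuclideanSpace ℝ (Fin n)))
    (g : EuclideanSpace ℝ (Fin n) → ℝ) (r : ℝ) (u : EuclideanSpace ℝ (Fin n) → ℝ)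
    (x : EuclideanSpace ℝ (Fin n)) : ℝ :=
  ∫ y in Ω ∩ closedBall x r, g y * u y

/-- `u` is a weak solution of `-div (a(l_r(u)) ∇u) = f` in `Ω`, `u ∈ H¹₀(Ω)`. -/
def IsSolutionPr {n : ℕ} (Ω : Set (EuclideanSpace ℝ (Fin n))) (a : ℝ → ℝ)
    (f g : EuclideanSpace ℝ (Fin n) → ℝ) (r : ℝ) (u : EuclideanSpace ℝ (Fin n) → ℝ) : Prop :=
  IsWeakSolution Ω (fun x => a (lr Ω g r u x)) f u

/-- The space `L²_r` of the ball of radius `d/2` centred at `0`: square integrable functions of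
the form `u(x) = p(‖x‖)` almost everywhere, with a profile `p` in `L²(]0, d/2[)`. -/
def MemRadialL2 {n : ℕ} (d : ℝ) (u : EuclideanSpace ℝ (Fin n) → ℝ) : Prop :=
  MemLp u 2 (volume.restrict (ball 0 (d / 2))) ∧
  ∃ p : ℝ → ℝ, MemLp p 2 (volume.restrict (Ioo 0 (d / 2))) ∧
    ∀ᵐ x ∂(volume.restrict (ball (0 : EuclideanSpace ℝ (Fin n)) (d / 2))), u x = p ‖x‖

/-- `a ∈ W^{1,∞}(ℝ)`: `a` is essentially bounded, with an essentially bounded weak derivative. -/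
def MemW1Infty (a : ℝ → ℝ) : Prop :=
  MemLp a ∞ volume ∧ ∃ b : ℝ → ℝ, MemLp b ∞ volume ∧
    ∀ ψ : ℝ → ℝ, IsTestFunction univ ψ → ∫ t, a t * deriv ψ t = - ∫ t, b t * ψ t

/-- The interval `I_r = [inf_Ω l_r(φ), sup_Ω l_r(φ)]`. -/
noncomputable def intervalIr {n : ℕ} (Ω : Set (EuclideanSpace ℝ (Fin n)))
    (g : EuclideanSpace ℝ (Fin n) → ℝ) (r : ℝ) (φ : EuclideanSpace ℝ (Fin n) → ℝ) : Set ℝ :=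
  Icc (sInf (lr Ω g r φ '' Ω)) (sSup (lr Ω g r φ '' Ω))

end NonlocalRadial

/-! For radial data the equation integrates explicitly. Put `R = d / 2`, let `p ≥ 0` be the profile
of `f`, and let `w(s) = s^(1-n) ∫_0^s t^(n-1) p(t) dt ≥ 0` be its flux. Whenever `A(x) θ(‖x‖) =
w(‖x‖)`, the potential `u(x) = ∫_{‖x‖}^R θ` lies in `H¹₀` and solves `-div (A ∇u) = f`
(`isWeakSolution_radialPotential`). In particular `φ` is a.e. the potential of `w`, by uniqueness
for the Laplacian. A radial solution of the nonlocal problem is therefore obtained from a profile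
`H` on `[0, R]` satisfying `H(‖x‖) = l_r(u)(x)`, where `u` is the potential of `w / a(H)`.

Such an `H` is a fixed point in `C([0, R])`. If `m_i ≤ H ≤ m_{i+1}`, then `1/a(m_i) ≤ 1/a(H) ≤
1/a(m_{i+1})`. Since `w` and `g` are nonnegative, `l_r(u)` lies between `l_r(φ)/a(m_i)` and
`l_r(φ)/a(m_{i+1})`, and the inclusion of `I_r` puts both bounds in `[m_i, m_{i+1}]`. The order
interval is thus mapped into itself. The image is equicontinuous because moving the centre of `B(x,
r)` changes its indicator little in `L¹(g)`, uniformly over bounded `u`. Schauder's theorem gives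
`H` (`exists_profile`, `exists_weightedPotential`). Different even indices give different solutions,
since the intervals `[m_i, m_{i+1}]` are disjoint and contain the values of `l_r(u_i)` at the
centre.

Schauder's theorem is derived from Brouwer's, and Brouwer's from a volume argument: a Lipschitz
retraction of a ball onto its sphere would make a polynomial in `t`, the volume of the image under
`id + t h`, vanish at `t = 1`, although it equals the volume of the ball for all small `t`. -/

/-! ### Volume of Lipschitz perturbations of the identity -/

open Filter Topology NNReal in
-- Along the segment `1 + s A`, `0 ≤ s ≤ 1`, every map is injective, so the determinant never
-- vanishes; it starts at `1`.
theorem ContinuousLinearMap.det_one_add_pos {E : Type*} [NormedAddCommGroup E] [NormedSpace ℝ E]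
    [FiniteDimensional ℝ E] (A : E →L[ℝ] E) (hA : ‖A‖ < 1) : 0 < (1 + A).det := by
  have hne : ∀ s ∈ Icc (0 : ℝ) 1, (1 + s • A).det ≠ 0 := by
    intro s hs h0
    have h1 : ¬ IsUnit (LinearMap.det ((1 + s • A : E →L[ℝ] E) : E →ₗ[ℝ] E)) := by
      rw [isUnit_iff_ne_zero, not_not]; exact h0
    rw [← LinearMap.isUnit_iff_isUnit_det, LinearMap.isUnit_iff_ker_eq_bot] at h1
    apply h1
    rw [LinearMap.ker_eq_bot']
    intro v hv
    have hv' : v = -(s • A v) := by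
      have : v + s • A v = 0 := by simpa using hv
      exact eq_neg_of_add_eq_zero_left this
    by_contra hv0
    have hpos : 0 < ‖v‖ := norm_pos_iff.2 hv0
    have : ‖v‖ ≤ ‖A‖ * ‖v‖ := by
      calc ‖v‖ = ‖s • A v‖ := by rw [← norm_neg (s • A v), ← hv']
        _ = |s| * ‖A v‖ := by rw [norm_smul, Real.norm_eq_abs]
        _ ≤ 1 * ‖A v‖ := by
            gcongr
            rw [abs_of_nonneg hs.1]; exact hs.2
        _ ≤ ‖A‖ * ‖v‖ := by rw [one_mul]; exact A.le_opNorm v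
    nlinarith
  have hcont : Continuous fun s : ℝ => (1 + s • A).det :=
    ContinuousLinearMap.continuous_det.comp (by fun_prop)
  by_contra! hle
  have h1 : (1 + (1 : ℝ) • A).det ≤ 0 := by simpa using hle
  have h0 : (0 : ℝ) ≤ (1 + (0 : ℝ) • A).det := by
    have : (1 + (0 : ℝ) • A).det = 1 := by
      rw [zero_smul, add_zero]; exact LinearMap.det_id
    rw [this]; exact zero_le_one
  obtain ⟨s, hs, hs0⟩ := intermediate_value_Icc' zero_le_one hcont.continuousOn ⟨h1, h0⟩
  exact hne s hs hs0

/-- `t ↦ det (1 + t A)` is a polynomial function of degree at most the dimension. -/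
theorem ContinuousLinearMap.exists_polynomial_det_one_add_smul {N : ℕ}
    (A : (Fin N → ℝ) →L[ℝ] (Fin N → ℝ)) :
    ∃ P : Polynomial ℝ, P.natDegree ≤ N ∧ ∀ t : ℝ, P.eval t = (1 + t • A).det := by
  classical
  set M := LinearMap.toMatrix' (A : (Fin N → ℝ) →ₗ[ℝ] (Fin N → ℝ)) with hM
  refine ⟨((Polynomial.X : Polynomial ℝ) • M.map (⇑Polynomial.C) +
    (1 : Matrix (Fin N) (Fin N) ℝ).map (⇑Polynomial.C)).det, ?_, fun t => ?_⟩
  · exact (Polynomial.natDegree_det_X_add_C_le M 1).trans (Fintype.card_fin N).le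
  · have h2 : (1 + t • A).det
        = (LinearMap.toMatrix' ((1 + t • A : (Fin N → ℝ) →L[ℝ] (Fin N → ℝ)) :
            (Fin N → ℝ) →ₗ[ℝ] (Fin N → ℝ))).det := by
      rw [LinearMap.det_toMatrix']
    rw [h2, ← Polynomial.coe_evalRingHom, RingHom.map_det]
    congr 1
    ext i j
    by_cases hij : i = j
    · subst hij
      simp [hM, LinearMap.toMatrix'_apply]
      ring
    · simp [hM, LinearMap.toMatrix'_apply, hij]
      ring

open Filter Topology NNReal in
-- A preimage of `y` is a fixed point of the contraction `x ↦ y - t h(x)`. Points outside the ball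
-- are fixed by `id + t h`, so injectivity prevents inner and outer points from being exchanged.
theorem LipschitzWith.image_id_add_smul_ball {E : Type*} [NormedAddCommGroup E] [NormedSpace ℝ E]
    [CompleteSpace E] {h : E → E} {K : ℝ≥0} (hh : LipschitzWith K h) {R : ℝ}
    (hR : ∀ x, R ≤ ‖x‖ → h x = 0) {t : ℝ} (ht : |t| * K < 1) :
    Function.Injective (fun x => x + t • h x) ∧
      (fun x => x + t • h x) '' ball 0 R = ball 0 R := by
  have hinj : Function.Injective (fun x => x + t • h x) := by
    intro x y hxy
    by_contra hne
    have hpos : 0 < ‖x - y‖ := norm_pos_iff.2 (sub_ne_zero.2 hne)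
    have h1 : x - y = -(t • (h x - h y)) := by
      have : x + t • h x = y + t • h y := hxy
      rw [smul_sub, ← sub_eq_zero]
      rw [← sub_eq_zero] at this
      rw [← this]; abel
    have h2 : ‖x - y‖ ≤ |t| * (K * ‖x - y‖) := by
      calc ‖x - y‖ = |t| * ‖h x - h y‖ := by
            conv_lhs => rw [h1]
            rw [norm_neg, norm_smul, Real.norm_eq_abs]
        _ ≤ _ := by
            gcongr
            simpa [dist_eq_norm] using hh.dist_le_mul x y
    nlinarith
  refine ⟨hinj, Subset.antisymm ?_ ?_⟩
  · rintro _ ⟨x, hx, rfl⟩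
    by_contra hle
    have hle' : R ≤ ‖x + t • h x‖ := by simpa using hle
    have : x + t • h x = x := hinj (by simp [hR _ hle'])
    rw [this] at hle'
    simp at hx
    linarith
  · intro y hy
    have hc : ContractingWith (‖t‖₊ * K) (fun x => y - t • h x) := by
      refine ⟨?_, ?_⟩
      · rw [← NNReal.coe_lt_coe]; simpa using ht
      · have : LipschitzWith (‖t‖₊ * K) (fun x => t • h x) :=
          (lipschitzWith_smul t).comp hh
        simpa using (LipschitzWith.const y).sub this
    obtain ⟨x, hx⟩ : ∃ x, y - t • h x = x := by
      obtain ⟨x, hx, -⟩ := hc.exists_fixedPoint 0 (edist_ne_top _ _)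
      exact ⟨x, hx⟩
    have hxy : x + t • h x = y := by
      conv_lhs => rw [← hx]
      rw [hx]; nth_rewrite 1 [← hx]; simp
    refine ⟨x, ?_, hxy⟩
    by_contra hle
    have hle' : R ≤ ‖x‖ := by simpa using hle
    rw [hR x hle'] at hxy
    simp at hxy hy
    rw [hxy] at hle'
    linarith

open Filter Topology NNReal in
/-- A Lipschitz map equal to the identity outside a ball has an invertible differential on a
subset of positive measure of the ball. -/
theorem LipschitzWith.not_ae_det_one_add_fderiv_eq_zero {N : ℕ} {h : (Fin N → ℝ) → (Fin N → ℝ)}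
    {K : ℝ≥0} (hh : LipschitzWith K h) {R : ℝ} (hR0 : 0 < R) (hR : ∀ x, R ≤ ‖x‖ → h x = 0)
    (hdet : ∀ x ∈ ball 0 R, DifferentiableAt ℝ h x → (1 + fderiv ℝ h x).det = 0) : False := by
  set D : Set (Fin N → ℝ) := ball 0 R ∩ {x | DifferentiableAt ℝ h x} with hD
  have hDm : MeasurableSet D := measurableSet_ball.inter (measurableSet_of_differentiableAt ℝ h)
  have hnull : volume (ball 0 R \ D) = 0 := by
    have h1 : ∀ᵐ x ∂(volume : Measure (Fin N → ℝ)), DifferentiableAt ℝ h x :=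
      hh.ae_differentiableAt
    refine measure_mono_null ?_ h1
    intro x hx hx'
    exact hx.2 ⟨hx.1, hx'⟩
  -- For small `t` the map `id + t h` is a bijection of the ball with positive Jacobian, so the
  -- change of variables formula gives a volume independent of `t`.
  have key : ∀ t : ℝ, 0 ≤ t → t * K < 1 →
      IntegrableOn (fun x => (1 + t • fderiv ℝ h x).det) D ∧
      ∫ x in D, (1 + t • fderiv ℝ h x).det = volume.real (ball (0 : Fin N → ℝ) R) := by
    intro t ht htK
    obtain ⟨hinj, himg⟩ := hh.image_id_add_smul_ball hR (t := t) (by rwa [abs_of_nonneg ht])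
    set G : (Fin N → ℝ) → (Fin N → ℝ) := fun x => x + t • h x with hG
    have hGlip : LipschitzWith (1 + ‖t‖₊ * K) G :=
      LipschitzWith.id.add ((lipschitzWith_smul t).comp hh)
    have hder : ∀ x ∈ D, HasFDerivWithinAt G (1 + t • fderiv ℝ h x) D x := by
      intro x hx
      exact ((hasFDerivAt_id x).add (hx.2.hasFDerivAt.const_smul t)).hasFDerivWithinAt
    have hpos : ∀ x ∈ D, |(1 + t • fderiv ℝ h x).det| • (1 : ℝ) = (1 + t • fderiv ℝ h x).det := by
      intro x hx
      rw [smul_eq_mul, mul_one, abs_of_pos]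
      apply ContinuousLinearMap.det_one_add_pos
      rw [norm_smul, Real.norm_eq_abs, abs_of_nonneg ht]
      refine lt_of_le_of_lt ?_ htK
      gcongr
      exact norm_fderiv_le_of_lipschitz ℝ hh
    have hvol : volume (G '' D) = volume (ball (0 : Fin N → ℝ) R) := by
      have h1 : volume (G '' (ball 0 R \ D)) = 0 := by
        -- Volume is the `N`-dimensional Hausdorff measure, for which Lipschitz images of null sets
        -- are null.
        rw [← hausdorffMeasure_pi_real] at hnull ⊢
        have h2 := hGlip.hausdorffMeasure_image_le (d := (Fintype.card (Fin N) : ℝ))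
          (Nat.cast_nonneg _) (ball 0 R \ D)
        rw [hnull, mul_zero] at h2
        exact le_antisymm h2 zero_le
      have hsub : D ⊆ ball 0 R := inter_subset_left
      apply le_antisymm
      · rw [← himg]; exact measure_mono (image_mono hsub)
      · calc volume (ball (0 : Fin N → ℝ) R) = volume (G '' D ∪ G '' (ball 0 R \ D)) := by
              rw [← image_union, union_sdiff_cancel hsub, himg]
          _ ≤ volume (G '' D) + volume (G '' (ball 0 R \ D)) := measure_union_le _ _
          _ = _ := by rw [h1, add_zero]
    have hfin : IntegrableOn (fun _ => (1 : ℝ)) (G '' D) := by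
      apply integrableOn_const
      · rw [hvol]; exact measure_ball_lt_top.ne
      · simp
    have hint := (integrableOn_image_iff_integrableOn_abs_det_fderiv_smul volume hDm hder
      hinj.injOn (fun _ => (1 : ℝ))).1 hfin
    refine ⟨hint.congr_fun hpos hDm, ?_⟩
    rw [← setIntegral_congr_fun hDm hpos,
      ← integral_image_eq_integral_abs_det_fderiv_smul volume hDm hder hinj.injOn (fun _ => (1 : ℝ))]
    rw [setIntegral_const, smul_eq_mul, mul_one, measureReal_def, hvol, measureReal_def]
  -- These are `N + 1` distinct nodes, all small enough for `key`. Lagrange interpolation at them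
  -- recovers the value at `t = 1` of a polynomial of degree at most `N`, so the coefficients of the
  -- determinant never have to be integrated separately.
  set v : ℕ → ℝ := fun k => (k + 1) / ((N + 2) * (K + 1)) with hv
  have hK0 : (0 : ℝ) ≤ K := K.2
  have hv0 : ∀ k, 0 ≤ v k := fun k => by positivity
  have hv1 : ∀ k ∈ Finset.range (N + 1), v k * K < 1 := by
    intro k hk
    have hk' : (k : ℝ) ≤ N := by exact_mod_cast Nat.lt_succ_iff.1 (Finset.mem_range.1 hk)
    rw [hv]
    simp only
    rw [div_mul_eq_mul_div, div_lt_one (by positivity)]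
    have : (k : ℝ) + 1 ≤ N + 1 := by linarith
    nlinarith
  have hvinj : InjOn v (Finset.range (N + 1)) := by
    intro i _ j _ hij
    have h3 : ((N : ℝ) + 2) * (K + 1) ≠ 0 := by positivity
    have h4 : (i : ℝ) + 1 = j + 1 := by
      have := hij
      simp only [hv] at this
      exact (div_left_inj' h3).1 this
    exact_mod_cast add_right_cancel h4
  set L : ℕ → ℝ := fun k => (Lagrange.basis (Finset.range (N + 1)) v k).eval 1 with hL
  have hinterp : ∀ P : Polynomial ℝ, P.natDegree ≤ N →
      P.eval 1 = ∑ k ∈ Finset.range (N + 1), P.eval (v k) * L k := by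
    intro P hP
    have hdeg : P.degree < (Finset.range (N + 1)).card := by
      rw [Finset.card_range]
      exact lt_of_le_of_lt Polynomial.degree_le_natDegree (by exact_mod_cast Nat.lt_succ_of_le hP)
    have := Lagrange.eq_interpolate hvinj hdeg
    conv_lhs => rw [this]
    rw [Lagrange.interpolate_apply, Polynomial.eval_finsetSum]
    simp [hL]
  have hsum1 : ∑ k ∈ Finset.range (N + 1), L k = 1 := by
    have := hinterp 1 (by simp)
    simpa using this.symm
  have hpt : ∀ x ∈ D, ∑ k ∈ Finset.range (N + 1), (1 + v k • fderiv ℝ h x).det * L k = 0 := by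
    intro x hx
    obtain ⟨P, hP, hPe⟩ := (fderiv ℝ h x).exists_polynomial_det_one_add_smul
    have h5 := hinterp P hP
    simp only [hPe, one_smul] at h5
    rw [← h5]; exact hdet x hx.1 hx.2
  have hI : ∫ x in D, ∑ k ∈ Finset.range (N + 1), (1 + v k • fderiv ℝ h x).det * L k
      = volume.real (ball (0 : Fin N → ℝ) R) := by
    rw [integral_finsetSum]
    · calc _ = ∑ k ∈ Finset.range (N + 1), volume.real (ball (0 : Fin N → ℝ) R) * L k := by
            refine Finset.sum_congr rfl fun k hk => ?_
            rw [integral_mul_const, (key (v k) (hv0 k) (hv1 k hk)).2]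
        _ = _ := by rw [← Finset.mul_sum, hsum1, mul_one]
    · intro k hk
      exact (key (v k) (hv0 k) (hv1 k hk)).1.mul_const _
  rw [setIntegral_congr_fun hDm hpt] at hI
  have hpos : 0 < volume.real (ball (0 : Fin N → ℝ) R) :=
    ENNReal.toReal_pos (measure_ball_pos volume 0 hR0).ne' measure_ball_lt_top.ne
  simp at hI
  linarith

/-! ### Brouwer's fixed point theorem -/

open NNReal in
theorem LipschitzWith.smul_of_bounded {X E : Type*} [PseudoMetricSpace X] [NormedAddCommGroup E]
    [NormedSpace ℝ E] {a : X → ℝ} {b : X → E} {Ka Kb A B : ℝ≥0} (ha : LipschitzWith Ka a)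
    (hb : LipschitzWith Kb b) (hA : ∀ x, |a x| ≤ A) (hB : ∀ x, ‖b x‖ ≤ B) :
    LipschitzWith (Ka * B + A * Kb) (fun x => a x • b x) := by
  refine LipschitzWith.of_dist_le_mul fun x y => ?_
  have h1 : a x • b x - a y • b y = (a x - a y) • b x + a y • (b x - b y) := by
    rw [sub_smul, smul_sub]; abel
  have h2 := ha.dist_le_mul x y
  have h3 := hb.dist_le_mul x y
  rw [Real.dist_eq] at h2
  rw [dist_eq_norm] at h3
  rw [dist_eq_norm, h1]
  calc _ ≤ |a x - a y| * ‖b x‖ + |a y| * ‖b x - b y‖ := by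
        refine (norm_add_le _ _).trans ?_
        rw [norm_smul, norm_smul, Real.norm_eq_abs, Real.norm_eq_abs]
    _ ≤ (Ka * dist x y) * B + A * (Kb * dist x y) := by
        gcongr
        · exact hB x
        · exact hA y
    _ = _ := by push_cast; ring

open NNReal in
theorem LipschitzWith.inv_norm_smul {X E : Type*} [PseudoMetricSpace X] [NormedAddCommGroup E]
    [NormedSpace ℝ E] {b : X → E} {K δ : ℝ≥0} (hb : LipschitzWith K b) (hδ : 0 < δ)
    (h : ∀ x, δ ≤ ‖b x‖) : LipschitzWith (2 * K / δ) (fun x => ‖b x‖⁻¹ • b x) := by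
  refine LipschitzWith.of_dist_le_mul fun x y => ?_
  have hx : 0 < ‖b x‖ := lt_of_lt_of_le (by exact_mod_cast hδ) (h x)
  have hy : 0 < ‖b y‖ := lt_of_lt_of_le (by exact_mod_cast hδ) (h y)
  have h3 := hb.dist_le_mul x y
  rw [dist_eq_norm] at h3
  have h1 : ‖b x‖⁻¹ • b x - ‖b y‖⁻¹ • b y
      = ‖b x‖⁻¹ • (b x - b y) + (‖b x‖⁻¹ * (‖b y‖ - ‖b x‖) * ‖b y‖⁻¹) • b y := by
    have : ‖b x‖⁻¹ * (‖b y‖ - ‖b x‖) * ‖b y‖⁻¹ = ‖b x‖⁻¹ - ‖b y‖⁻¹ := by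
      field_simp
    rw [this, smul_sub, sub_smul]; abel
  have h4 : |‖b y‖ - ‖b x‖| ≤ ‖b x - b y‖ := by
    rw [norm_sub_rev]; exact abs_norm_sub_norm_le _ _
  have hδ' : (0 : ℝ) < δ := by exact_mod_cast hδ
  rw [dist_eq_norm, h1]
  calc _ ≤ ‖b x‖⁻¹ * ‖b x - b y‖ + ‖b x‖⁻¹ * |‖b y‖ - ‖b x‖| := by
        refine (norm_add_le _ _).trans (le_of_eq ?_)
        rw [norm_smul, norm_smul, Real.norm_eq_abs, Real.norm_eq_abs, abs_mul, abs_mul,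
          abs_of_pos (inv_pos.2 hx), abs_of_pos (inv_pos.2 hy)]
        field_simp
    _ ≤ (δ : ℝ)⁻¹ * (K * dist x y) + (δ : ℝ)⁻¹ * (K * dist x y) := by
        have := inv_anti₀ hδ' (h x)
        gcongr
        exact h4.trans h3
    _ = _ := by push_cast; field_simp; ring

/-- A map whose norm is constant near `x` has singular differential at `x`. -/
theorem det_eq_zero_of_norm_eventually_const {E : Type*} [NormedAddCommGroup E] [NormedSpace ℝ E]
    [FiniteDimensional ℝ E] {r : E → E} {r' : E →L[ℝ] E} {x : E} (hr : HasFDerivAt r r' x) {c : ℝ}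
    (hc : 0 < c) (hn : ∀ᶠ y in nhds x, ‖r y‖ = c) : r'.det = 0 := by
  by_contra hdet
  have hu : IsUnit (LinearMap.det (r' : E →ₗ[ℝ] E)) := isUnit_iff_ne_zero.2 hdet
  rw [← LinearMap.isUnit_iff_isUnit_det, LinearMap.isUnit_iff_range_eq_top,
    LinearMap.range_eq_top] at hu
  -- Moving from `x` by `s v` multiplies `r x` by `1 + s` to first order. The norm would grow by `s
  -- c`, up to an error of at most `s c / 2`.
  obtain ⟨v, hv⟩ := hu (r x)
  have hline : HasDerivAt (fun s : ℝ => x + s • v) v 0 := by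
    simpa using ((hasDerivAt_id (0 : ℝ)).smul_const v).const_add x
  have hr0 : HasFDerivAt r r' (x + (0 : ℝ) • v) := by simpa using hr
  have h1 : HasDerivAt (fun s : ℝ => r (x + s • v)) (r x) 0 := by
    have := hr0.comp_hasDerivAt (0 : ℝ) hline
    rw [show r' v = r x from hv] at this
    exact this
  rw [hasDerivAt_iff_isLittleO_nhds_zero] at h1
  have h2 := h1.def (c := c / 2) (by positivity)
  have h3 : ∀ᶠ s : ℝ in nhds 0, ‖r (x + s • v)‖ = c := by
    have hcont : Filter.Tendsto (fun s : ℝ => x + s • v) (nhds 0) (nhds x) := by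
      simpa using hline.continuousAt.tendsto
    exact hcont.eventually hn
  have h4 : ∀ᶠ s : ℝ in nhdsWithin 0 (Ioi 0), 0 < s := eventually_mem_nhdsWithin
  obtain ⟨s, ⟨hs2, hs3⟩, hs⟩ := (((h2.and h3).filter_mono nhdsWithin_le_nhds).and h4).exists
  simp only [zero_add, zero_smul, add_zero] at hs2
  have hx : ‖r x‖ = c := hn.self_of_nhds
  have h5 : ‖(1 + s) • r x‖ = (1 + s) * c := by
    rw [norm_smul, Real.norm_eq_abs, abs_of_pos (by linarith), hx]
  have h6 : ‖(1 + s) • r x‖ ≤ ‖r (x + s • v)‖ + ‖r (x + s • v) - r x - s • r x‖ := by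
    have : (1 + s) • r x = r (x + s • v) - (r (x + s • v) - r x - s • r x) := by
      rw [add_smul, one_smul]; abel
    rw [this]; exact norm_sub_le _ _
  rw [Real.norm_eq_abs, abs_of_pos hs] at hs2
  nlinarith

open NNReal in
-- Without a fixed point, `G = id - lam f` has no zero, where the cutoff `lam` is `1` on the unit
-- ball and `0` outside radius `2`. Then `2 G / ‖G‖` is a Lipschitz retraction of the ball of radius
-- `2` onto its sphere. Its norm is constant, so its differential is singular wherever it exists,
-- contradicting the volume argument.
theorem LipschitzWith.exists_fixedPoint_mem_closedBall {N : ℕ} {f : (Fin N → ℝ) → (Fin N → ℝ)}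
    {K : ℝ≥0} (hf : LipschitzWith K f) (hf1 : ∀ x, ‖f x‖ ≤ 1) :
    ∃ x, ‖x‖ ≤ 1 ∧ f x = x := by
  by_contra! hno
  set lam : (Fin N → ℝ) → ℝ := fun x => max 0 (min 1 (2 - ‖x‖)) with hlam
  have hlam0 : ∀ x, 0 ≤ lam x := fun x => le_max_left _ _
  have hlam1 : ∀ x, |lam x| ≤ (1 : ℝ≥0) := fun x => by
    rw [abs_of_nonneg (hlam0 x)]; simp [hlam]
  have hlamL : LipschitzWith 1 lam := by
    have h1 : LipschitzWith 1 fun x : Fin N → ℝ => 2 - ‖x‖ := by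
      simpa using (LipschitzWith.const (2 : ℝ)).sub lipschitzWith_one_norm
    exact (h1.const_min 1).const_max 0
  set G : (Fin N → ℝ) → (Fin N → ℝ) := fun x => x - lam x • f x with hG
  have hbL : LipschitzWith (1 * 1 + 1 * K) (fun x => lam x • f x) :=
    hlamL.smul_of_bounded hf hlam1 (fun x => by simpa using hf1 x)
  have hGL : LipschitzWith (1 + (1 * 1 + 1 * K)) G := LipschitzWith.id.sub hbL
  have hGout : ∀ x, 2 ≤ ‖x‖ → G x = x := by
    intro x hx
    have : lam x = 0 := by
      simp only [hlam]
      exact max_eq_left ((min_le_right _ _).trans (by linarith))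
    simp [hG, this]
  have hlamf : ∀ x, ‖lam x • f x‖ ≤ lam x := by
    intro x
    rw [norm_smul, Real.norm_eq_abs, abs_of_nonneg (hlam0 x)]
    exact mul_le_of_le_one_right (hlam0 x) (hf1 x)
  have hGle : ∀ x, ‖x‖ ≤ 2 → ‖G x‖ ≤ 2 := by
    intro x hx
    have h1 := (_root_.norm_sub_le x (lam x • f x)).trans (add_le_add_right (hlamf x) _)
    have h2 : lam x ≤ 2 - ‖x‖ ∨ ‖x‖ ≤ 0 := by
      left
      exact max_le (by linarith) (min_le_right _ _)
    rcases h2 with h2 | h2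
    · linarith
    · have := hlam1 x
      rw [abs_of_nonneg (hlam0 x)] at this
      simp at this
      linarith
  have hGne : ∀ x, G x ≠ 0 := by
    intro x hx
    have hx' : x = lam x • f x := sub_eq_zero.1 hx
    have h1 : ‖x‖ ≤ lam x := by
      have := hlamf x
      rwa [← hx'] at this
    rcases le_or_gt ‖x‖ 1 with h | h
    · apply hno x h
      have : lam x = 1 := by
        simp only [hlam]
        rw [min_eq_left (by linarith)]; simp
      rw [this, one_smul] at hx'
      exact hx'.symm
    · have : lam x < ‖x‖ := by
        simp only [hlam]
        exact max_lt (by linarith) (lt_of_le_of_lt (min_le_right _ _) (by linarith))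
      linarith
  obtain ⟨δ, hδ, hGδ⟩ : ∃ δ : ℝ≥0, 0 < δ ∧ ∀ x, δ ≤ ‖G x‖ := by
    obtain ⟨x₀, -, hx₀⟩ := (isCompact_closedBall (0 : Fin N → ℝ) 2).exists_isMinOn
      ⟨0, by simp⟩ (hGL.continuous.norm.continuousOn)
    refine ⟨min ‖G x₀‖₊ 2, lt_min (by simpa using hGne x₀) (by norm_num), fun x => ?_⟩
    rcases le_or_gt ‖x‖ 2 with h | h
    · have h1 : ‖G x₀‖ ≤ ‖G x‖ := hx₀ (by simpa using h)
      refine le_trans ?_ h1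
      simp
    · rw [hGout x h.le]
      refine le_trans ?_ h.le
      simp
  -- Adding `m G / ‖G‖` to `G` gives `2 G / ‖G‖` inside the ball of radius `2`, where `‖G‖ ≤ 2`, and
  -- leaves `G = id` unchanged outside it.
  set m : (Fin N → ℝ) → ℝ := fun x => max (2 - ‖G x‖) 0 with hm
  have hmL : LipschitzWith (1 + (1 * 1 + 1 * K)) m := by
    have h1 := ((LipschitzWith.const (α := Fin N → ℝ) (2 : ℝ)).sub
      (lipschitzWith_one_norm.comp hGL)).max_const 0
    simpa using h1
  have hm2 : ∀ x, |m x| ≤ (2 : ℝ≥0) := by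
    intro x
    rw [abs_of_nonneg (le_max_right _ _)]
    exact max_le (by simp) (by simp)
  have hnL := hGL.inv_norm_smul hδ hGδ
  have hn1 : ∀ x, ‖‖G x‖⁻¹ • G x‖ ≤ (1 : ℝ≥0) := by
    intro x
    rw [norm_smul, norm_inv, norm_norm, inv_mul_cancel₀ (norm_ne_zero_iff.2 (hGne x))]
    simp
  set h : (Fin N → ℝ) → (Fin N → ℝ) :=
    fun x => m x • (‖G x‖⁻¹ • G x) - lam x • f x with hh
  have hL := (hmL.smul_of_bounded hnL hm2 hn1).sub hbL
  refine hL.not_ae_det_one_add_fderiv_eq_zero (R := 2) two_pos ?_ ?_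
  · intro x hx
    have h1 : m x = 0 := by
      simp only [hm]; rw [hGout x hx]; exact max_eq_right (by linarith)
    have h2 : lam x • f x = 0 := by
      have := hGout x hx
      simpa [hG] using this
    rw [h1, h2]; simp
  · intro x hx hd
    have hder : HasFDerivAt (fun y => y + h y) (1 + fderiv ℝ h x) x :=
      (hasFDerivAt_id x).add hd.hasFDerivAt
    refine det_eq_zero_of_norm_eventually_const hder (c := 2) two_pos ?_
    filter_upwards [isOpen_ball.mem_nhds hx] with y hy
    have hy2 : ‖y‖ ≤ 2 := by simpa using (mem_ball_zero_iff.1 hy).le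
    have h1 : y + h y = (2 / ‖G y‖) • G y := by
      have h2 : m y = 2 - ‖G y‖ := max_eq_left (by linarith [hGle y hy2])
      have h3 : y + h y = G y + m y • (‖G y‖⁻¹ • G y) := by
        simp only [hh, hG]; abel
      rw [h3, h2, smul_smul]
      nth_rewrite 1 [← one_smul ℝ (G y)]
      rw [← add_smul]
      congr 1
      have := norm_ne_zero_iff.2 (hGne y)
      field_simp
      ring
    rw [h1, norm_smul, Real.norm_eq_abs, abs_of_nonneg (by positivity),
      div_mul_cancel₀ _ (norm_ne_zero_iff.2 (hGne y))]

open Filter Topology Manifold in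
-- The constant value `f x` is locally admissible; a smooth partition of unity averages these
-- constants without leaving the convex sets.
theorem Continuous.exists_contDiff_approx_mem_convex {E F : Type*} [NormedAddCommGroup E] [NormedSpace ℝ E]
    [FiniteDimensional ℝ E] [NormedAddCommGroup F] [NormedSpace ℝ F] {f : E → F}
    (hf : Continuous f) {C : Set F} (hC : Convex ℝ C) (hfC : ∀ x, f x ∈ C) {δ : ℝ} (hδ : 0 < δ) :
    ∃ g : E → F, ContDiff ℝ ∞ g ∧ ∀ x, g x ∈ C ∧ dist (g x) (f x) < δ := by
  obtain ⟨g, hg⟩ := exists_contMDiffMap_forall_mem_convex_of_local_const (n := (⊤ : ℕ∞)) 𝓘(ℝ, E)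
    (t := fun x => C ∩ ball (f x) δ) (fun x => hC.inter (convex_ball _ _)) (fun x => by
      refine ⟨f x, ?_⟩
      filter_upwards [hf.continuousAt.preimage_mem_nhds (ball_mem_nhds (f x) hδ)] with y hy
      exact ⟨hfC x, by rw [mem_ball']; exact hy⟩)
  exact ⟨g, g.contMDiff.contDiff, fun x => ⟨(hg x).1, (hg x).2⟩⟩

open NNReal in
/-- **Brouwer's fixed point theorem** for the cube `[-1, 1]^N`. -/
theorem ContinuousOn.exists_fixedPoint_mem_closedBall {N : ℕ} {f : (Fin N → ℝ) → (Fin N → ℝ)}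
    (hf : ContinuousOn f (closedBall 0 1)) (hmaps : MapsTo f (closedBall 0 1) (closedBall 0 1)) :
    ∃ x ∈ closedBall (0 : Fin N → ℝ) 1, f x = x := by
  set p : (Fin N → ℝ) → (Fin N → ℝ) := fun x i => max (-1) (min 1 (x i)) with hp
  have hpL : LipschitzWith 1 p :=
    LipschitzWith.of_dist_le_mul fun x y => by
      rw [NNReal.coe_one, one_mul, dist_pi_le_iff dist_nonneg]
      intro i
      have h1 : LipschitzWith 1 fun s : ℝ => max (-1) (min 1 s) :=
        (LipschitzWith.id.const_min 1).const_max (-1)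
      have h2 := h1.dist_le_mul (x i) (y i)
      rw [NNReal.coe_one, one_mul] at h2
      exact h2.trans (dist_le_pi_dist x y i)
  have hpm : ∀ x, p x ∈ closedBall (0 : Fin N → ℝ) 1 := by
    intro x
    rw [mem_closedBall_zero_iff, pi_norm_le_iff_of_nonneg zero_le_one]
    intro i
    rw [Real.norm_eq_abs, abs_le]
    exact ⟨le_max_left _ _, max_le (by norm_num) (min_le_left _ _)⟩
  have hpid : ∀ x ∈ closedBall (0 : Fin N → ℝ) 1, p x = x := by
    intro x hx
    ext i
    have h1 := (norm_le_pi_norm x i).trans (mem_closedBall_zero_iff.1 hx)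
    rw [Real.norm_eq_abs, abs_le] at h1
    simp only [hp]
    rw [min_eq_right h1.2, max_eq_right h1.1]
  have hFc : Continuous (f ∘ p) := hf.comp_continuous hpL.continuous hpm
  by_contra! hno
  -- By compactness the displacement of `f ∘ p` has a positive minimum on the cube. A smooth
  -- approximation closer than this minimum still has a fixed point when composed with the clamp
  -- `p`, which is absurd.
  obtain ⟨x₀, hx₀, hmin⟩ := (isCompact_closedBall (0 : Fin N → ℝ) 1).exists_isMinOn
    ⟨0, by simp⟩ ((hFc.sub continuous_id).norm.continuousOn)
  have hδ : 0 < ‖f (p x₀) - x₀‖ := by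
    rw [norm_pos_iff]
    rw [hpid x₀ hx₀]
    exact sub_ne_zero.2 (hno x₀ hx₀)
  obtain ⟨g, hg, hgf⟩ := hFc.exists_contDiff_approx_mem_convex
    (convex_closedBall (0 : Fin N → ℝ) 1) (fun x => hmaps (hpm x)) hδ
  obtain ⟨K, hK⟩ := hg.contDiffOn.exists_lipschitzOnWith (by simp)
    (convex_closedBall (0 : Fin N → ℝ) 1) (isCompact_closedBall _ _)
  have hgp : LipschitzWith (K * 1) (g ∘ p) := by
    rw [← lipschitzOnWith_univ]
    exact hK.comp hpL.lipschitzOnWith (fun x _ => hpm x)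
  obtain ⟨x, hx1, hx⟩ := hgp.exists_fixedPoint_mem_closedBall
    (fun x => mem_closedBall_zero_iff.1 (hgf (p x)).1)
  have hxm : x ∈ closedBall (0 : Fin N → ℝ) 1 := mem_closedBall_zero_iff.2 hx1
  have h1 := (hgf x).2
  simp only [Function.comp_apply, hpid x hxm] at hx h1
  rw [hx] at h1
  have h2 : ‖f (p x₀) - x₀‖ ≤ ‖f (p x) - x‖ := hmin hxm
  simp only [hpid x hxm] at h2
  rw [dist_comm, dist_eq_norm] at h1
  linarith

/-! ### Schauder's fixed point theorem -/

/-- Approximate fixed points of a map of a convex set with totally bounded image. -/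
theorem ContinuousOn.exists_dist_lt_of_totallyBounded_image {E : Type*} [NormedAddCommGroup E]
    [NormedSpace ℝ E] {C : Set E} (hC : Convex ℝ C) (hne : C.Nonempty) {T : E → E}
    (hT : ContinuousOn T C) (hmaps : MapsTo T C C) (htb : TotallyBounded (T '' C)) {ε : ℝ}
    (hε : 0 < ε) : ∃ x ∈ C, dist (T x) x < ε := by
  classical
  obtain ⟨t, htC, htfin, hcov⟩ := totallyBounded_iff_subset.1 htb _ (dist_mem_uniformity hε)
  obtain ⟨N, y, hy⟩ : ∃ (N : ℕ) (y : Fin N → E), range y = t := by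
    obtain ⟨N, y, -, hy⟩ := htfin.fin_param
    exact ⟨N, y, hy⟩
  have hyC : ∀ j, y j ∈ C := fun j => by
    have h1 : y j ∈ T '' C := htC (hy ▸ mem_range_self j)
    exact hmaps.image_subset h1
  -- These are the weights of the Schauder projection: only the net points within `ε` of `z` count.
  set μ : E → Fin N → ℝ := fun z j => max 0 (ε - dist z (y j)) with hμ
  have hμ0 : ∀ z j, 0 ≤ μ z j := fun z j => le_max_left _ _
  have hμc : Continuous μ := by
    refine continuous_pi fun j => ?_
    simp only [hμ]
    fun_prop
  have hμpos : ∀ x ∈ C, 0 < ‖μ (T x)‖ := by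
    intro x hx
    have h1 := hcov (mem_image_of_mem T hx)
    simp only [mem_iUnion, mem_ofPred_eq] at h1
    obtain ⟨w, hw, hwx⟩ := h1
    obtain ⟨j, rfl⟩ : w ∈ range y := hy ▸ hw
    rw [norm_pos_iff]
    intro h0
    have h2 : μ (T x) j = 0 := by rw [h0]; rfl
    have h3 : ε - dist (T x) (y j) ≤ μ (T x) j := le_max_right _ _
    have h4 : dist (T x) (y j) < ε := hwx
    linarith
  -- This turns points of the cube into admissible weights, so that Brouwer's theorem for the cube
  -- applies instead of one for the simplex. The sum is positive on the whole cube, and on the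
  -- sphere `‖c‖ = 1` the weights reduce to `|c j|`.
  set wt : (Fin N → ℝ) → Fin N → ℝ := fun c j => |c j| + (1 - ‖c‖) with hwt
  have hwt0 : ∀ c ∈ closedBall (0 : Fin N → ℝ) 1, ∀ j, 0 ≤ wt c j := by
    intro c hc j
    have := mem_closedBall_zero_iff.1 hc
    have := abs_nonneg (c j)
    simp only [hwt]; linarith
  have hN : 0 < N := by
    obtain ⟨x, hx⟩ := hne
    rcases Nat.eq_zero_or_pos N with h | h
    · subst h
      have := hμpos x hx
      rw [Subsingleton.elim (μ (T x)) 0, norm_zero] at this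
      exact absurd this (lt_irrefl _)
    · exact h
  have hwtpos : ∀ c ∈ closedBall (0 : Fin N → ℝ) 1, 0 < ∑ j, wt c j := by
    intro c hc
    refine lt_of_le_of_ne (Finset.sum_nonneg fun j _ => hwt0 c hc j) fun h0 => ?_
    have hz := (Finset.sum_eq_zero_iff_of_nonneg fun j _ => hwt0 c hc j).1 h0.symm
    have hc1 := mem_closedBall_zero_iff.1 hc
    have h1 : ∀ j, |c j| = 0 ∧ 1 - ‖c‖ = 0 := by
      intro j
      have h2 : |c j| + (1 - ‖c‖) = 0 := hz j (Finset.mem_univ j)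
      have h3 := abs_nonneg (c j)
      constructor <;> linarith
    have h4 : c = 0 := by
      ext j; exact abs_eq_zero.1 (h1 j).1
    have h5 := (h1 ⟨0, hN⟩).2
    rw [h4, norm_zero] at h5
    norm_num at h5
  set X : (Fin N → ℝ) → E := fun c => Finset.univ.centerMass (wt c) y with hX
  have hXC : ∀ c ∈ closedBall (0 : Fin N → ℝ) 1, X c ∈ C := fun c hc =>
    hC.centerMass_mem (fun j _ => hwt0 c hc j) (hwtpos c hc) fun j _ => hyC j
  have hXc : ContinuousOn X (closedBall 0 1) := by
    have h1 : ∀ j, Continuous fun c : Fin N → ℝ => wt c j := fun j => by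
      simp only [hwt]; fun_prop
    simp only [hX, Finset.centerMass]
    refine ContinuousOn.smul (ContinuousOn.inv₀ ?_ fun c hc => (hwtpos c hc).ne') ?_
    · exact (continuous_finsetSum _ fun j _ => h1 j).continuousOn
    · exact (continuous_finsetSum _ fun j _ => (h1 j).smul continuous_const).continuousOn
  have hTX : ContinuousOn (fun c => μ (T (X c))) (closedBall 0 1) :=
    hμc.comp_continuousOn (hT.comp hXc hXC)
  obtain ⟨c, hc, hfix⟩ := ContinuousOn.exists_fixedPoint_mem_closedBall
    (f := fun c => ‖μ (T (X c))‖⁻¹ • μ (T (X c)))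
    ((hTX.norm.inv₀ fun c hc => (hμpos _ (hXC c hc)).ne').smul hTX) (by
      intro c hc
      rw [mem_closedBall_zero_iff, norm_smul, norm_inv, norm_norm,
        inv_mul_cancel₀ (hμpos _ (hXC c hc)).ne'])
  set z := T (X c) with hz
  have hpos := hμpos _ (hXC c hc)
  have hcnorm : ‖c‖ = 1 := by
    rw [← hfix, norm_smul, norm_inv, norm_norm, inv_mul_cancel₀ hpos.ne']
  -- The fixed point has norm `1` and nonnegative coordinates, so its weights are `c` itself. Hence
  -- `X c` is the Schauder projection of `z = T (X c)`.
  have hwtc : wt c = ‖μ z‖⁻¹ • μ z := by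
    ext j
    have h1 : 0 ≤ c j := by
      rw [← hfix]
      exact mul_nonneg (inv_nonneg.2 (norm_nonneg _)) (hμ0 z j)
    simp only [hwt]
    rw [hcnorm, sub_self, add_zero, abs_of_nonneg h1]
    exact (congrFun hfix j).symm
  refine ⟨X c, hXC c hc, ?_⟩
  have hmem : X c ∈ ball z ε := by
    simp only [hX]
    rw [← Finset.centerMass_filter_ne_zero]
    refine (convex_ball z ε).centerMass_mem (fun j _ => hwt0 c hc j) ?_ fun j hj => ?_
    · rw [Finset.sum_filter_ne_zero]
      exact hwtpos c hc
    · have h1 : wt c j ≠ 0 := (Finset.mem_filter.1 hj).2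
      rw [hwtc] at h1
      have h2 : μ z j ≠ 0 := fun h0 => h1 (by simp [h0])
      rw [mem_ball, dist_comm]
      by_contra! hle
      exact h2 (max_eq_left (by linarith))
  rw [dist_comm]; exact hmem

/-- **Schauder's fixed point theorem.** -/
theorem ContinuousOn.exists_fixedPoint_of_subset_isCompact {E : Type*} [NormedAddCommGroup E]
    [NormedSpace ℝ E] {C S : Set E} (hC : Convex ℝ C) (hcl : IsClosed C) (hne : C.Nonempty)
    {T : E → E} (hT : ContinuousOn T C) (hmaps : MapsTo T C C) (hS : IsCompact S)
    (hTS : MapsTo T C S) : ∃ x ∈ C, T x = x := by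
  have htb : TotallyBounded (T '' C) := hS.totallyBounded.subset hTS.image_subset
  have happ : ∀ k : ℕ, ∃ x ∈ C, dist (T x) x < 1 / ((k : ℝ) + 1) := fun k =>
    hT.exists_dist_lt_of_totallyBounded_image hC hne hmaps htb (by positivity)
  choose x hxC hx using happ
  obtain ⟨y, -, φ, hφ, hy⟩ := hS.tendsto_subseq fun k => hTS (hxC k)
  have hd : Filter.Tendsto (fun k => dist (T (x (φ k))) (x (φ k))) Filter.atTop (nhds 0) := by
    refine squeeze_zero (fun _ => dist_nonneg) (fun k => (hx (φ k)).le) ?_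
    exact tendsto_one_div_add_atTop_nhds_zero_nat.comp hφ.tendsto_atTop
  have hxy : Filter.Tendsto (fun k => x (φ k)) Filter.atTop (nhds y) :=
    (tendsto_iff_of_dist hd).1 hy
  have hyC : y ∈ C := hcl.mem_of_tendsto hxy (Filter.Eventually.of_forall fun k => hxC _)
  refine ⟨y, hyC, ?_⟩
  have h1 : Filter.Tendsto (fun k => T (x (φ k))) Filter.atTop (nhds (T y)) :=
    (hT y hyC).tendsto.comp (tendsto_nhdsWithin_iff.2
      ⟨hxy, Filter.Eventually.of_forall fun k => hxC _⟩)
  exact tendsto_nhds_unique h1 hy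

/-! ### Inequalities in `L²` -/

theorem MeasureTheory.MemLp.integrable_inner_two {α E : Type*} [MeasurableSpace α] {μ : Measure α}
    [NormedAddCommGroup E] [InnerProductSpace ℝ E] {F H : α → E} (hF : MemLp F 2 μ)
    (hH : MemLp H 2 μ) : Integrable (fun x => inner ℝ (F x) (H x)) μ := by
  refine (L2.integrable_inner (𝕜 := ℝ) hF.toLp hH.toLp).congr ?_
  filter_upwards [hF.coeFn_toLp, hH.coeFn_toLp] with x h1 h2
  rw [h1, h2]

/-- The Cauchy–Schwarz inequality in `L²`. -/
theorem MeasureTheory.MemLp.abs_integral_inner_le {α E : Type*} [MeasurableSpace α]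
    {μ : Measure α} [NormedAddCommGroup E] [InnerProductSpace ℝ E] {F H : α → E}
    (hF : MemLp F 2 μ) (hH : MemLp H 2 μ) :
    |∫ x, inner ℝ (F x) (H x) ∂μ| ≤ (eLpNorm F 2 μ).toReal * (eLpNorm H 2 μ).toReal := by
  have h1 : ∫ x, inner ℝ (F x) (H x) ∂μ = inner ℝ hF.toLp hH.toLp := by
    rw [L2.inner_def]
    refine integral_congr_ae ?_
    filter_upwards [hF.coeFn_toLp, hH.coeFn_toLp] with x h1 h2
    rw [h1, h2]
  rw [h1, ← Lp.norm_toLp F hF, ← Lp.norm_toLp H hH]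
  exact abs_real_inner_le_norm _ _

theorem MeasureTheory.MemLp.integrable_mul_two {α : Type*} [MeasurableSpace α] {μ : Measure α}
    {f g : α → ℝ} (hf : MemLp f 2 μ) (hg : MemLp g 2 μ) : Integrable (fun x => f x * g x) μ := by
  simpa [mul_comm] using hf.integrable_inner_two hg

theorem MeasureTheory.MemLp.abs_integral_mul_le {α : Type*} [MeasurableSpace α] {μ : Measure α}
    {f g : α → ℝ} (hf : MemLp f 2 μ) (hg : MemLp g 2 μ) :
    |∫ x, f x * g x ∂μ| ≤ (eLpNorm f 2 μ).toReal * (eLpNorm g 2 μ).toReal := by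
  simpa [mul_comm] using hf.abs_integral_inner_le hg

theorem eq_of_forall_abs_sub_le_mul {a b C : ℝ} (h : ∀ ε > 0, |a - b| ≤ C * ε) : a = b := by
  by_contra hne
  have hpos : 0 < |a - b| := abs_pos.2 (sub_ne_zero.2 hne)
  have h1 := h (|a - b| / (2 * (|C| + 1))) (by positivity)
  have h2 : C * (|a - b| / (2 * (|C| + 1))) ≤ (|C| + 1) * (|a - b| / (2 * (|C| + 1))) := by
    gcongr
    linarith [le_abs_self C]
  have h3 : (|C| + 1) * (|a - b| / (2 * (|C| + 1))) = |a - b| / 2 := by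
    field_simp
  linarith

theorem ENNReal.toReal_le_of_lt_ofReal {a : ℝ≥0∞} {ε : ℝ} (hε : 0 ≤ ε)
    (h : a < ENNReal.ofReal ε) : a.toReal ≤ ε :=
  ENNReal.toReal_le_of_le_ofReal hε h.le

namespace NonlocalRadial

/-! ### Calculus of test functions -/

section TestFunctions

variable {n : ℕ} {Ω : Set (EuclideanSpace ℝ (Fin n))} {ψ η : EuclideanSpace ℝ (Fin n) → ℝ}

theorem gradient_apply (ψ : EuclideanSpace ℝ (Fin n) → ℝ) (x : EuclideanSpace ℝ (Fin n))
    (i : Fin n) : (gradient ψ x) i = fderiv ℝ ψ x (EuclideanSpace.single i 1) := by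
  rw [← inner_gradient_left, real_inner_comm, EuclideanSpace.inner_single_left]
  simp

theorem IsTestFunction.continuous_gradient (h : IsTestFunction Ω ψ) :
    Continuous (gradient ψ) := by
  have h1 : Continuous (fderiv ℝ ψ) := h.smooth.continuous_fderiv (by simp)
  exact (InnerProductSpace.toDual ℝ _).symm.continuous.comp h1

theorem IsTestFunction.hasCompactSupport_gradient (h : IsTestFunction Ω ψ) :
    HasCompactSupport (gradient ψ) := by
  have h1 : HasCompactSupport (fderiv ℝ ψ) := h.compact.fderiv ℝ
  exact h1.comp_left (g := (InnerProductSpace.toDual ℝ _).symm) (map_zero _)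

theorem IsTestFunction.memLp (h : IsTestFunction Ω ψ) : MemLp ψ 2 (volume.restrict Ω) :=
  (h.smooth.continuous.memLp_of_hasCompactSupport h.compact).restrict _

theorem IsTestFunction.memLp_gradient (h : IsTestFunction Ω ψ) :
    MemLp (gradient ψ) 2 (volume.restrict Ω) :=
  (h.continuous_gradient.memLp_of_hasCompactSupport h.hasCompactSupport_gradient).restrict _

theorem gradient_sub_apply (hψ : Differentiable ℝ ψ) (hη : Differentiable ℝ η)
    (x : EuclideanSpace ℝ (Fin n)) :
    gradient (fun y => ψ y - η y) x = gradient ψ x - gradient η x := by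
  unfold gradient
  rw [fderiv_fun_sub (hψ x) (hη x), map_sub]

theorem IsTestFunction.differentiable (h : IsTestFunction Ω ψ) : Differentiable ℝ ψ :=
  h.smooth.differentiable (by simp)

theorem IsTestFunction.sub (hψ : IsTestFunction Ω ψ) (hη : IsTestFunction Ω η) :
    IsTestFunction Ω (fun x => ψ x - η x) where
  smooth := hψ.smooth.sub hη.smooth
  compact := hψ.compact.sub hη.compact
  support_subset := (tsupport_sub _ _).trans (union_subset hψ.support_subset hη.support_subset)

theorem IsTestFunction.eq_zero_of_notMem (h : IsTestFunction Ω ψ) {x : EuclideanSpace ℝ (Fin n)}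
    (hx : x ∉ Ω) : ψ x = 0 :=
  image_eq_zero_of_notMem_tsupport fun h' => hx (h.support_subset h')

theorem IsTestFunction.gradient_eq_zero_of_notMem (h : IsTestFunction Ω ψ)
    {x : EuclideanSpace ℝ (Fin n)} (hx : x ∉ Ω) : gradient ψ x = 0 := by
  have h1 : fderiv ℝ ψ x = 0 := by
    by_contra h2
    exact hx (h.support_subset (support_fderiv_subset ℝ h2))
  simp [gradient, h1]

theorem IsTestFunction.integral_mul_gradient (hψ : IsTestFunction Ω ψ) (hη : IsTestFunction Ω η)
    (i : Fin n) : ∫ x in Ω, ψ x * (gradient η x) i = - ∫ x in Ω, (gradient ψ x) i * η x := by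
  have hc : ∀ {ζ : EuclideanSpace ℝ (Fin n) → ℝ}, IsTestFunction Ω ζ →
      Continuous fun x => fderiv ℝ ζ x (EuclideanSpace.single i 1) := fun h =>
    (h.smooth.continuous_fderiv (by simp)).clm_apply continuous_const
  rw [setIntegral_eq_integral_of_forall_compl_eq_zero
    (fun x hx => by rw [hψ.eq_zero_of_notMem hx, zero_mul]),
    setIntegral_eq_integral_of_forall_compl_eq_zero
    (fun x hx => by rw [hη.eq_zero_of_notMem hx, mul_zero])]
  simp only [gradient_apply]
  refine integral_mul_fderiv_eq_neg_fderiv_mul_of_integrable ?_ ?_ ?_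
    (fun x _ => hψ.differentiable x) (fun x _ => hη.differentiable x)
  · exact ((hc hψ).mul hη.smooth.continuous).integrable_of_hasCompactSupport hη.compact.mul_left
  · exact (hψ.smooth.continuous.mul (hc hη)).integrable_of_hasCompactSupport hψ.compact.mul_right
  · exact (hψ.smooth.continuous.mul hη.smooth.continuous).integrable_of_hasCompactSupport
      hψ.compact.mul_right

end TestFunctions

/-! ### The space `H¹₀`, Poincaré's inequality and uniqueness -/

section Sobolev

variable {n : ℕ} {Ω : Set (EuclideanSpace ℝ (Fin n))}

/-- The closure property defining `H¹₀(Ω)`. -/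
def IsH1Limit (Ω : Set (EuclideanSpace ℝ (Fin n))) (u : EuclideanSpace ℝ (Fin n) → ℝ)
    (G : EuclideanSpace ℝ (Fin n) → EuclideanSpace ℝ (Fin n)) : Prop :=
  ∀ ε : ℝ≥0∞, 0 < ε → ∃ ψ, IsTestFunction Ω ψ ∧
    eLpNorm (fun x => u x - ψ x) 2 (volume.restrict Ω) < ε ∧
    eLpNorm (fun x => G x - gradient ψ x) 2 (volume.restrict Ω) < ε

/-- An identity `∫ F · ∇ψ = ∫ f ψ` valid for test functions extends to `H¹`-limits of those. -/
theorem integral_inner_eq_of_isH1Limit {u f : EuclideanSpace ℝ (Fin n) → ℝ}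
    {G F : EuclideanSpace ℝ (Fin n) → EuclideanSpace ℝ (Fin n)}
    (hu : MemLp u 2 (volume.restrict Ω)) (hG : MemLp G 2 (volume.restrict Ω))
    (hlim : IsH1Limit Ω u G)
    (hf : MemLp f 2 (volume.restrict Ω)) (hF : MemLp F 2 (volume.restrict Ω))
    (htest : ∀ ψ, IsTestFunction Ω ψ →
      ∫ x in Ω, inner ℝ (F x) (gradient ψ x) = ∫ x in Ω, f x * ψ x) :
    ∫ x in Ω, inner ℝ (F x) (G x) = ∫ x in Ω, f x * u x := by
  refine eq_of_forall_abs_sub_le_mul (C := (eLpNorm F 2 (volume.restrict Ω)).toReal +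
    (eLpNorm f 2 (volume.restrict Ω)).toReal) fun ε hε => ?_
  obtain ⟨ψ, hψ, h1, h2⟩ := hlim (ENNReal.ofReal ε) (ENNReal.ofReal_pos.2 hε)
  have hGψ := hG.sub hψ.memLp_gradient
  have huψ := hu.sub hψ.memLp
  have e1 : (∫ x in Ω, inner ℝ (F x) (G x)) - ∫ x in Ω, f x * u x
      = (∫ x in Ω, inner ℝ (F x) ((G - gradient ψ) x)) - ∫ x in Ω, f x * (u - ψ) x := by
    simp only [Pi.sub_apply, inner_sub_right, mul_sub]
    rw [integral_sub (hF.integrable_inner_two hG) (hF.integrable_inner_two hψ.memLp_gradient),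
      integral_sub (hf.integrable_mul_two hu) (hf.integrable_mul_two hψ.memLp), htest ψ hψ]
    ring
  rw [e1, add_mul]
  refine (abs_sub _ _).trans (add_le_add ?_ ?_)
  · refine (hF.abs_integral_inner_le hGψ).trans ?_
    gcongr
    exact ENNReal.toReal_le_of_lt_ofReal hε.le h2
  · refine (hf.abs_integral_mul_le huψ).trans ?_
    gcongr
    exact ENNReal.toReal_le_of_lt_ofReal hε.le h1

/-- The weak gradient identity passes to `H¹`-limits: it is the preceding lemma with the field `η
e_i` and the function `-∂_i η`. Only the approximation remains to be checked for membership in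
`H¹₀`. -/
theorem MemH01.of_isH1Limit {u : EuclideanSpace ℝ (Fin n) → ℝ}
    {G : EuclideanSpace ℝ (Fin n) → EuclideanSpace ℝ (Fin n)}
    (hu : MemLp u 2 (volume.restrict Ω)) (hG : MemLp G 2 (volume.restrict Ω))
    (hlim : IsH1Limit Ω u G) : MemH01 Ω u G where
  memLp := hu
  memLp_grad := hG
  approx := hlim
  weakGradient := by
    intro η hη i
    have hF : MemLp (fun x => η x • (EuclideanSpace.single i (1 : ℝ))) 2 (volume.restrict Ω) := by
      have h1 : HasCompactSupport (fun x => η x • (EuclideanSpace.single i (1 : ℝ))) :=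
        hη.compact.smul_right
      exact ((hη.smooth.continuous.smul continuous_const).memLp_of_hasCompactSupport h1).restrict _
    have hf : MemLp (fun x => - (gradient η x) i) 2 (volume.restrict Ω) := by
      have h1 := hη.memLp_gradient.const_inner (𝕜 := ℝ) (EuclideanSpace.single i (1 : ℝ))
      simp only [EuclideanSpace.inner_single_left, map_one, one_mul] at h1
      exact h1.neg
    have h := integral_inner_eq_of_isH1Limit hu hG hlim hf hF (fun ψ hψ => by
      have h1 := hη.integral_mul_gradient hψ i
      simp only [inner_smul_left, EuclideanSpace.inner_single_left, neg_mul, integral_neg]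
      simpa using h1)
    simp only [inner_smul_left, EuclideanSpace.inner_single_left, neg_mul, integral_neg] at h
    have h' : ∫ x in Ω, η x * (G x) i = - ∫ x in Ω, (gradient η x) i * u x := by simpa using h
    simp only [mul_comm (u _), mul_comm ((G _) i)]
    rw [h', neg_neg]

theorem MemH01.sub {u v : EuclideanSpace ℝ (Fin n) → ℝ}
    {G H : EuclideanSpace ℝ (Fin n) → EuclideanSpace ℝ (Fin n)} (hu : MemH01 Ω u G)
    (hv : MemH01 Ω v H) : MemH01 Ω (fun x => u x - v x) (fun x => G x - H x) := by
  refine MemH01.of_isH1Limit (hu.memLp.sub hv.memLp) (hu.memLp_grad.sub hv.memLp_grad) ?_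
  intro ε hε
  have hε2 : 0 < ε / 2 := ENNReal.half_pos hε.ne'
  obtain ⟨ψ, hψ, h1, h2⟩ := hu.approx (ε / 2) hε2
  obtain ⟨η, hη, h3, h4⟩ := hv.approx (ε / 2) hε2
  refine ⟨_, hψ.sub hη, ?_, ?_⟩
  · have e : (fun x => u x - v x - (ψ x - η x)) = (fun x => u x - ψ x) - fun x => v x - η x := by
      ext x; simp only [Pi.sub_apply]; ring
    rw [e]
    refine lt_of_le_of_lt (eLpNorm_sub_le (hu.memLp.sub hψ.memLp).1 (hv.memLp.sub hη.memLp).1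
      one_le_two) ?_
    rw [← ENNReal.add_halves ε]
    exact ENNReal.add_lt_add h1 h3
  · have e : (fun x => G x - H x - gradient (fun y => ψ y - η y) x)
        = (fun x => G x - gradient ψ x) - fun x => H x - gradient η x := by
      ext1 x
      simp only [Pi.sub_apply]
      rw [gradient_sub_apply hψ.differentiable hη.differentiable]; abel
    rw [e]
    refine lt_of_le_of_lt (eLpNorm_sub_le (hu.memLp_grad.sub hψ.memLp_gradient).1
      (hv.memLp_grad.sub hη.memLp_gradient).1 one_le_two) ?_
    rw [← ENNReal.add_halves ε]
    exact ENNReal.add_lt_add h2 h4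

/-- The Poincaré inequality for test functions of a ball. -/
theorem IsTestFunction.eLpNorm_le_of_ball (hn : 0 < n) {R : ℝ} (hR : 0 ≤ R)
    {ψ : EuclideanSpace ℝ (Fin n) → ℝ} (hψ : IsTestFunction (ball 0 R) ψ) :
    (eLpNorm ψ 2 (volume.restrict (ball 0 R))).toReal ≤
      2 * R * (eLpNorm (gradient ψ) 2 (volume.restrict (ball 0 R))).toReal := by
  set i : Fin n := ⟨0, hn⟩
  set Ω : Set (EuclideanSpace ℝ (Fin n)) := ball 0 R
  set e : EuclideanSpace ℝ (Fin n) := EuclideanSpace.single i 1 with he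
  have hcd : Continuous fun x => fderiv ℝ ψ x e :=
    (hψ.smooth.continuous_fderiv (by simp)).clm_apply continuous_const
  have hψc := hψ.smooth.continuous
  have hcoord : ∀ x : EuclideanSpace ℝ (Fin n),
      HasFDerivAt (fun y : EuclideanSpace ℝ (Fin n) => y i)
        (EuclideanSpace.proj i : EuclideanSpace ℝ (Fin n) →L[ℝ] ℝ) x := fun x =>
    (EuclideanSpace.proj i : EuclideanSpace ℝ (Fin n) →L[ℝ] ℝ).hasFDerivAt
  have hci : Continuous fun x : EuclideanSpace ℝ (Fin n) => x i :=
    (EuclideanSpace.proj i : EuclideanSpace ℝ (Fin n) →L[ℝ] ℝ).continuous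
  have hd2 : ∀ x, fderiv ℝ (fun y => ψ y * ψ y) x e = 2 * ψ x * fderiv ℝ ψ x e := by
    intro x
    rw [fderiv_fun_mul (hψ.differentiable x) (hψ.differentiable x)]
    simp; ring
  -- Integrating `x_i` against the derivative of `ψ²` gives `∫ ψ² = -2 ∫ x_i ψ ∂_i ψ`. With `|x_i| ≤
  -- R` and Cauchy–Schwarz this yields the constant `2 R`.
  have hparts := integral_mul_fderiv_eq_neg_fderiv_mul_of_integrable
    (μ := (volume : Measure (EuclideanSpace ℝ (Fin n))))
    (f := fun x : EuclideanSpace ℝ (Fin n) => x i) (g := fun x => ψ x * ψ x) (v := e)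
    (by
      simp only [fun x => (hcoord x).fderiv]
      exact (continuous_const.mul (hψc.mul hψc)).integrable_of_hasCompactSupport
        (hψ.compact.mul_left.mul_left))
    (by
      simp only [hd2]
      exact (hci.mul ((continuous_const.mul hψc).mul hcd)).integrable_of_hasCompactSupport
        (hψ.compact.mul_left.mul_right.mul_left))
    ((hci.mul (hψc.mul hψc)).integrable_of_hasCompactSupport (hψ.compact.mul_left.mul_left))
    (fun x _ => (hcoord x).differentiableAt)
    (fun x _ => (hψ.differentiable x).mul (hψ.differentiable x))
  simp only [hd2, fun x => (hcoord x).fderiv] at hparts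
  have hpe : (EuclideanSpace.proj i : EuclideanSpace ℝ (Fin n) →L[ℝ] ℝ) e = 1 := by simp [he]
  simp only [hpe, one_mul] at hparts
  have hF : MemLp (fun x => (x i * ψ x) • e) 2 (volume.restrict Ω) :=
    (((hci.mul hψc).smul continuous_const).memLp_of_hasCompactSupport
      (hψ.compact.mul_left.smul_right)).restrict _
  have h1 : (eLpNorm ψ 2 (volume.restrict Ω)).toReal ^ 2 = ∫ x in Ω, ψ x * ψ x := by
    have h2 := real_inner_self_eq_norm_sq (hψ.memLp.toLp)
    rw [Lp.norm_toLp] at h2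
    rw [← h2, L2.inner_def]
    refine integral_congr_ae ?_
    filter_upwards [hψ.memLp.coeFn_toLp] with x hx
    rw [hx, real_inner_self_eq_norm_sq, Real.norm_eq_abs, sq_abs, sq]
  have h2 : ∫ x in Ω, ψ x * ψ x = - (2 * ∫ x in Ω, inner ℝ ((x i * ψ x) • e) (gradient ψ x)) := by
    rw [setIntegral_eq_integral_of_forall_compl_eq_zero
      (fun x hx => by rw [hψ.eq_zero_of_notMem hx, zero_mul]),
      setIntegral_eq_integral_of_forall_compl_eq_zero
      (fun x hx => by rw [hψ.eq_zero_of_notMem hx]; simp), ← integral_const_mul,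
      ← neg_eq_iff_eq_neg, ← hparts]
    congr 1
    ext x
    rw [inner_smul_left, real_inner_comm, inner_gradient_left]
    simp; ring
  have h3 := hF.abs_integral_inner_le hψ.memLp_gradient
  have h4 : (eLpNorm (fun x => (x i * ψ x) • e) 2 (volume.restrict Ω)).toReal ≤
      R * (eLpNorm ψ 2 (volume.restrict Ω)).toReal := by
    have h5 : eLpNorm (fun x => (x i * ψ x) • e) 2 (volume.restrict Ω) ≤
        ENNReal.ofReal R * eLpNorm ψ 2 (volume.restrict Ω) := by
      refine eLpNorm_le_mul_eLpNorm_of_ae_le_mul ?_ 2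
      refine (ae_restrict_iff' measurableSet_ball).2 (Filter.Eventually.of_forall fun x hx => ?_)
      have h6 : ‖e‖ = 1 := by simp [he]
      have h7 : |x i| ≤ R := by
        have := PiLp.norm_apply_le x i
        exact this.trans (mem_ball_zero_iff.1 hx).le
      rw [norm_smul, h6, mul_one, norm_mul]
      gcongr
      exact h7
    have h8 := ENNReal.toReal_mono (ENNReal.mul_ne_top ENNReal.ofReal_ne_top
      hψ.memLp.eLpNorm_ne_top) h5
    rwa [ENNReal.toReal_mul, ENNReal.toReal_ofReal hR] at h8
  set A := (eLpNorm ψ 2 (volume.restrict Ω)).toReal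
  set B := (eLpNorm (gradient ψ) 2 (volume.restrict Ω)).toReal
  have hA : 0 ≤ A := ENNReal.toReal_nonneg
  have hB : 0 ≤ B := ENNReal.toReal_nonneg
  have h9 : A ^ 2 ≤ 2 * R * B * A := by
    rw [h1, h2]
    have h10 := neg_le_of_abs_le (h3.trans (mul_le_mul_of_nonneg_right h4 hB))
    linarith
  rcases hA.eq_or_lt with h0 | h0
  · rw [← h0]; positivity
  · exact le_of_mul_le_mul_right (by linarith [sq A]) h0

/-- Since `H` vanishes a.e., the approximating test functions have small gradients, hence small `L²`
norms by Poincaré's inequality. -/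
theorem MemH01.ae_eq_zero_of_ball (hn : 0 < n) {R : ℝ} (hR : 0 ≤ R)
    {v : EuclideanSpace ℝ (Fin n) → ℝ}
    {H : EuclideanSpace ℝ (Fin n) → EuclideanSpace ℝ (Fin n)} (hv : MemH01 (ball 0 R) v H)
    (hH : ∫ x in ball 0 R, inner ℝ (H x) (H x) = (0 : ℝ)) : v =ᵐ[volume.restrict (ball 0 R)] 0 := by
  set Ω : Set (EuclideanSpace ℝ (Fin n)) := ball 0 R
  have hH0 : H =ᵐ[volume.restrict Ω] 0 := by
    have h1 := (integral_eq_zero_iff_of_nonneg (fun x => real_inner_self_nonneg)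
      (hv.memLp_grad.integrable_inner_two hv.memLp_grad)).1 hH
    filter_upwards [h1] with x hx
    exact inner_self_eq_zero.1 hx
  have hz : (eLpNorm v 2 (volume.restrict Ω)).toReal = 0 := by
    refine eq_of_forall_abs_sub_le_mul (C := 1 + 2 * R) fun ε hε => ?_
    obtain ⟨ψ, hψ, h1, h2⟩ := hv.approx (ENNReal.ofReal ε) (ENNReal.ofReal_pos.2 hε)
    have h3 : eLpNorm (gradient ψ) 2 (volume.restrict Ω) < ENNReal.ofReal ε := by
      refine lt_of_le_of_lt (le_of_eq ?_) h2
      rw [← eLpNorm_neg]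
      refine eLpNorm_congr_ae ?_
      filter_upwards [hH0] with x hx
      simp [hx]
    have h4 := hψ.eLpNorm_le_of_ball hn hR
    have h5 : (eLpNorm v 2 (volume.restrict Ω)).toReal ≤
        (eLpNorm (fun x => v x - ψ x) 2 (volume.restrict Ω)).toReal +
        (eLpNorm ψ 2 (volume.restrict Ω)).toReal := by
      have hfin : eLpNorm (fun x => v x - ψ x) 2 (volume.restrict Ω) ≠ ⊤ :=
        (hv.memLp.sub hψ.memLp).eLpNorm_ne_top
      rw [← ENNReal.toReal_add hfin hψ.memLp.eLpNorm_ne_top]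
      refine ENNReal.toReal_mono (ENNReal.add_ne_top.2 ⟨hfin, hψ.memLp.eLpNorm_ne_top⟩) ?_
      have : v = (fun x => v x - ψ x) + ψ := by ext x; simp
      conv_lhs => rw [this]
      exact eLpNorm_add_le (hv.memLp.sub hψ.memLp).1 hψ.memLp.1 one_le_two
    have h6 := ENNReal.toReal_le_of_lt_ofReal hε.le h1
    have h7 := ENNReal.toReal_le_of_lt_ofReal hε.le h3
    rw [sub_zero, abs_of_nonneg ENNReal.toReal_nonneg]
    have h8 : 2 * R * (eLpNorm (gradient ψ) 2 (volume.restrict Ω)).toReal ≤ 2 * R * ε := by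
      gcongr
    linarith
  rw [ENNReal.toReal_eq_zero_iff] at hz
  exact (eLpNorm_eq_zero_iff hv.memLp.1 two_ne_zero).1
    (hz.resolve_right hv.memLp.eLpNorm_ne_top)

/-- Uniqueness for the Dirichlet problem `-Δu = f` in a ball. -/
theorem IsWeakSolution.ae_eq_of_ball (hn : 0 < n) {R : ℝ} (hR : 0 ≤ R)
    {f u v : EuclideanSpace ℝ (Fin n) → ℝ} (hu : IsWeakSolution (ball 0 R) (fun _ => 1) f u)
    (hv : IsWeakSolution (ball 0 R) (fun _ => 1) f v) : u =ᵐ[volume.restrict (ball 0 R)] v := by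
  obtain ⟨G, hG, h1⟩ := hu
  obtain ⟨H, hH, h2⟩ := hv
  have hd := hG.sub hH
  have h3 := (h1 _ _ hd).trans (h2 _ _ hd).symm
  simp only [one_mul] at h3
  have h4 : ∫ x in ball 0 R, inner ℝ (G x - H x) (G x - H x) = (0 : ℝ) := by
    simp only [fun x => inner_sub_left (𝕜 := ℝ) (G x) (H x) (G x - H x)]
    rw [integral_sub (hG.memLp_grad.integrable_inner_two hd.memLp_grad)
      (hH.memLp_grad.integrable_inner_two hd.memLp_grad), h3, sub_self]
  filter_upwards [hd.ae_eq_zero_of_ball hn hR h4] with x hx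
  exact sub_eq_zero.1 hx

end Sobolev

/-! ### Transfer between radial functions and their profiles -/

/-- In polar coordinates the law of `‖x‖` has density `k s^(n-1) ≤ k R^(n-1)`. Null sets and `L²`
bounds for profiles therefore pass to the ball. -/
theorem exists_map_norm_restrict_ball_le {n : ℕ} (hn : 0 < n) (R : ℝ) :
    ∃ C : ℝ≥0∞, C ≠ ⊤ ∧ (volume.restrict (ball (0 : EuclideanSpace ℝ (Fin n)) R)).map norm ≤
      C • volume.restrict (Ioo 0 R) := by
  have : Nonempty (Fin n) := ⟨⟨0, hn⟩⟩
  set k : ℝ := Module.finrank ℝ (EuclideanSpace ℝ (Fin n)) * (volume.real (ball (0 : (EuclideanSpace ℝ (Fin n))) 1)) with hk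
  have hk0 : 0 ≤ k := by positivity
  refine ⟨ENNReal.ofReal (k * R ^ (n - 1)), ENNReal.ofReal_ne_top, ?_⟩
  refine Measure.le_iff.2 fun s hs => ?_
  rw [Measure.map_apply measurable_norm hs, Measure.restrict_apply (measurable_norm hs),
    Measure.smul_apply, Measure.restrict_apply hs, smul_eq_mul]
  set s' := s ∩ Ioo 0 R with hs'
  have hs'm : MeasurableSet s' := hs.inter measurableSet_Ioo
  have hs'fin : volume s' ≠ ⊤ := measure_ne_top_of_subset inter_subset_right (by simp)
  have hpre : volume (norm ⁻¹' s' : Set (EuclideanSpace ℝ (Fin n))) ≠ ⊤ := by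
    refine measure_ne_top_of_subset (s := ball (0 : (EuclideanSpace ℝ (Fin n))) R) (fun x hx => ?_)
      (measure_ball_lt_top (μ := volume)).ne
    exact mem_ball_zero_iff.2 hx.2.2
  have hsub : (norm ⁻¹' s ∩ ball 0 R : Set (EuclideanSpace ℝ (Fin n))) ⊆ norm ⁻¹' s' ∪ {0} := by
    intro x hx
    rcases eq_or_ne x 0 with h | h
    · right; exact h
    · left; exact ⟨hx.1, norm_pos_iff.2 h, mem_ball_zero_iff.1 hx.2⟩
  have hle : volume (norm ⁻¹' s ∩ ball 0 R : Set (EuclideanSpace ℝ (Fin n))) ≤ volume (norm ⁻¹' s' : Set (EuclideanSpace ℝ (Fin n))) := by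
    refine (measure_mono hsub).trans ((measure_union_le _ _).trans ?_)
    simp
  refine hle.trans ?_
  rw [← ENNReal.ofReal_toReal hpre, ← ENNReal.ofReal_toReal hs'fin,
    ← ENNReal.ofReal_mul' ENNReal.toReal_nonneg]
  rcases s'.eq_empty_or_nonempty with hemp | ⟨y₀, hy₀⟩
  · simp [hemp]
  have hR : 0 ≤ R := (hy₀.2.1.trans hy₀.2.2).le
  refine ENNReal.ofReal_le_ofReal ?_
  have h1 := integral_fun_norm_addHaar (volume : Measure (EuclideanSpace ℝ (Fin n))) (s'.indicator (fun _ => (1 : ℝ)))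
  have h2 : ∫ x : (EuclideanSpace ℝ (Fin n)), s'.indicator (fun _ => (1 : ℝ)) ‖x‖
      = (volume (norm ⁻¹' s' : Set (EuclideanSpace ℝ (Fin n)))).toReal := by
    have : (fun x : (EuclideanSpace ℝ (Fin n)) => s'.indicator (fun _ => (1 : ℝ)) ‖x‖)
        = (norm ⁻¹' s' : Set (EuclideanSpace ℝ (Fin n))).indicator (fun _ => (1 : ℝ)) := by
      ext x; rfl
    rw [this, integral_indicator (measurable_norm hs'm)]
    simp [measureReal_def]
  rw [h2] at h1
  rw [h1, nsmul_eq_mul, smul_eq_mul, ← mul_assoc, ← hk, mul_assoc k]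
  gcongr
  have hfr : Module.finrank ℝ (EuclideanSpace ℝ (Fin n)) = n := finrank_euclideanSpace_fin
  rw [hfr]
  have h3 : ∫ y in Ioi (0 : ℝ), R ^ (n - 1) * s'.indicator (fun _ => (1 : ℝ)) y
      = R ^ (n - 1) * (volume s').toReal := by
    rw [integral_const_mul, setIntegral_indicator hs'm]
    have : Ioi (0 : ℝ) ∩ s' = s' := inter_eq_right.2 fun y hy => hy.2.1
    rw [this]; simp [measureReal_def]
  rw [← h3]
  have hi : IntegrableOn (s'.indicator fun _ => (1 : ℝ)) (Ioi 0) :=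
    (((integrable_indicator_iff hs'm).2 (integrableOn_const hs'fin)).integrableOn)
  refine integral_mono_of_nonneg ?_ (hi.const_mul _) ?_
  · refine (ae_restrict_iff' measurableSet_Ioi).2 (Filter.Eventually.of_forall fun y hy => ?_)
    have hy' : (0 : ℝ) < y := hy
    simp only [Pi.zero_apply, smul_eq_mul]
    exact mul_nonneg (by positivity) (indicator_nonneg (fun _ _ => zero_le_one) _)
  · refine (ae_restrict_iff' measurableSet_Ioi).2 (Filter.Eventually.of_forall fun y hy => ?_)
    have hy' : (0 : ℝ) < y := hy
    simp only [smul_eq_mul]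
    by_cases hys : y ∈ s'
    · have := hys.2.2.le
      gcongr
      exact indicator_nonneg (fun _ _ => zero_le_one) _
    · simp [hys]

theorem quasiMeasurePreserving_norm_ball {n : ℕ} (hn : 0 < n) (R : ℝ) :
    Measure.QuasiMeasurePreserving norm (volume.restrict (ball (0 : EuclideanSpace ℝ (Fin n)) R))
      (volume.restrict (Ioo 0 R)) := by
  obtain ⟨C, -, hC⟩ := exists_map_norm_restrict_ball_le hn R
  exact ⟨measurable_norm, (Measure.absolutelyContinuous_of_le hC).trans
    (Measure.smul_absolutelyContinuous)⟩

theorem exists_eLpNorm_comp_norm_le {n : ℕ} (hn : 0 < n) (R : ℝ) :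
    ∃ C : ℝ≥0∞, C ≠ ⊤ ∧ ∀ θ : ℝ → ℝ, AEStronglyMeasurable θ (volume.restrict (Ioo 0 R)) →
      eLpNorm (fun x : EuclideanSpace ℝ (Fin n) => θ ‖x‖) 2 (volume.restrict (ball 0 R)) ≤
        C * eLpNorm θ 2 (volume.restrict (Ioo 0 R)) := by
  obtain ⟨C, hC, hle⟩ := exists_map_norm_restrict_ball_le hn R
  refine ⟨C ^ (1 / (2 : ℝ)), by simp [hC], fun θ hθ => ?_⟩
  have h1 : AEStronglyMeasurable θ
      ((volume.restrict (ball (0 : EuclideanSpace ℝ (Fin n)) R)).map norm) :=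
    hθ.mono_ac (quasiMeasurePreserving_norm_ball hn R).2
  have h2 := eLpNorm_map_measure (p := 2) h1 measurable_norm.aemeasurable
  have h3 : eLpNorm (fun x : EuclideanSpace ℝ (Fin n) => θ ‖x‖) 2 (volume.restrict (ball 0 R))
      = eLpNorm θ 2 ((volume.restrict (ball (0 : EuclideanSpace ℝ (Fin n)) R)).map norm) :=
    h2.symm
  rw [h3]
  refine (eLpNorm_mono_measure θ hle).trans ?_
  rw [eLpNorm_smul_measure_of_ne_top (by simp), smul_eq_mul]
  simp

/-- A smooth approximation of `θ` restricted to `[a, R - a]` is cut off inside the interval. The two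
end strips carry little of the norm by absolute continuity of the integral. -/
theorem exists_isTestFunction_Ioo_eLpNorm_sub_le {R : ℝ} (hR : 0 < R) {θ : ℝ → ℝ}
    (hθ : MemLp θ 2 (volume.restrict (Ioo 0 R))) {δ : ℝ} (hδ : 0 < δ) :
    ∃ η, IsTestFunction (Ioo 0 R) η ∧
      eLpNorm (fun s => θ s - η s) 2 (volume.restrict (Ioo 0 R)) ≤ ENNReal.ofReal δ := by
  obtain ⟨δ', hδ', hsmall⟩ := hθ.eLpNorm_indicator_le one_le_two (by simp) (half_pos hδ)
  set a := min (δ' / 2) (R / 4) with ha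
  have ha0 : 0 < a := lt_min (by positivity) (by positivity)
  have haR : a ≤ R / 4 := min_le_right _ _
  have haδ : 2 * a ≤ δ' := by linarith [min_le_left (δ' / 2) (R / 4)]
  set K := Icc a (R - a) with hK
  have hKsub : K ⊆ Ioo 0 R := fun s hs => ⟨by linarith [hs.1], by linarith [hs.2]⟩
  have h1 : eLpNorm (Kᶜ.indicator θ) 2 (volume.restrict (Ioo 0 R)) ≤ ENNReal.ofReal (δ / 2) := by
    refine hsmall _ measurableSet_Icc.compl ?_
    rw [Measure.restrict_apply measurableSet_Icc.compl]
    have hs : Kᶜ ∩ Ioo 0 R ⊆ Ioo 0 a ∪ Ioo (R - a) R := by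
      rintro s ⟨hs1, hs2⟩
      by_cases h : s < a
      · left; exact ⟨hs2.1, h⟩
      · right
        refine ⟨?_, hs2.2⟩
        by_contra h'
        exact hs1 ⟨not_lt.1 h, not_lt.1 h'⟩
    refine (measure_mono hs).trans ((measure_union_le _ _).trans ?_)
    rw [Real.volume_Ioo, Real.volume_Ioo, ← ENNReal.ofReal_add (by linarith) (by linarith)]
    exact ENNReal.ofReal_le_ofReal (by linarith)
  have hθ1 : MemLp (K.indicator θ) 2 volume := by
    rw [memLp_indicator_iff_restrict measurableSet_Icc]
    exact hθ.mono_measure (Measure.restrict_mono hKsub le_rfl)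
  obtain ⟨g, hgc, hgs, hg⟩ := hθ1.exist_eLpNorm_sub_le (by simp) one_le_two (half_pos hδ)
  -- The radii make `χ` equal to `1` on `K = [a, R - a]` and supported in `[a/2, R - a/2]`.
  set χ : ContDiffBump (R / 2) := ⟨R / 2 - a, R / 2 - a / 2, by linarith, by linarith⟩ with hχ
  have hχ1 : ∀ s ∈ K, χ s = 1 := fun s hs => χ.one_of_mem_closedBall (by
    rw [mem_closedBall, Real.dist_eq, abs_le]
    exact ⟨by simp only [hχ]; linarith [hs.1], by simp only [hχ]; linarith [hs.2]⟩)
  refine ⟨fun s => χ s * g s, ⟨χ.contDiff.mul hgs, hgc.mul_left, ?_⟩, ?_⟩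
  · refine (tsupport_mul_subset_left (f := χ) (g := g)).trans ?_
    rw [χ.tsupport_eq]
    intro s hs
    rw [mem_closedBall, Real.dist_eq, abs_le] at hs
    simp only [hχ] at hs
    exact ⟨by linarith [hs.1], by linarith [hs.2]⟩
  · have e : (fun s => θ s - χ s * g s)
        = Kᶜ.indicator θ + fun s => χ s * (K.indicator θ s - g s) := by
      ext s
      by_cases hs : s ∈ K
      · simp [hs, hχ1 s hs]
      · simp [hs]; ring
    have hm1 : AEStronglyMeasurable (Kᶜ.indicator θ) (volume.restrict (Ioo 0 R)) :=
      hθ.1.indicator measurableSet_Icc.compl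
    have hm2 : AEStronglyMeasurable (fun s => K.indicator θ s - g s) volume :=
      hθ1.1.sub hgs.continuous.aestronglyMeasurable
    rw [e]
    refine (eLpNorm_add_le hm1 (χ.continuous.aestronglyMeasurable.mul hm2).restrict
      one_le_two).trans ?_
    have h2 : eLpNorm (fun s => χ s * (K.indicator θ s - g s)) 2 (volume.restrict (Ioo 0 R))
        ≤ ENNReal.ofReal (δ / 2) := by
      refine le_trans (eLpNorm_mono fun s => ?_) ((eLpNorm_restrict_le _ _ _ _).trans hg)
      rw [norm_mul, Real.norm_eq_abs, abs_of_nonneg χ.nonneg]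
      exact mul_le_of_le_one_left (norm_nonneg _) χ.le_one
    refine (add_le_add h1 h2).trans ?_
    rw [← ENNReal.ofReal_add (by positivity) (by positivity), add_halves]

/-! ### Radial potentials -/

/-- The radial function with radial derivative `-θ` vanishing on the sphere of radius `R`. -/
noncomputable def radialPotential {n : ℕ} (R : ℝ) (θ : ℝ → ℝ) (x : EuclideanSpace ℝ (Fin n)) : ℝ :=
  ∫ s in Ioo ‖x‖ R, θ s

/-- The radial vector field `-θ(‖x‖) x / ‖x‖`. -/
noncomputable def radialField {n : ℕ} (θ : ℝ → ℝ) (x : EuclideanSpace ℝ (Fin n)) :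
    EuclideanSpace ℝ (Fin n) :=
  -(θ ‖x‖ • (‖x‖⁻¹ • x))

theorem norm_radialField_le {n : ℕ} (θ : ℝ → ℝ) (x : EuclideanSpace ℝ (Fin n)) :
    ‖radialField θ x‖ ≤ ‖θ ‖x‖‖ := by
  rw [radialField, norm_neg, norm_smul]
  refine mul_le_of_le_one_right (norm_nonneg _) ?_
  rw [norm_smul, norm_inv, norm_norm]
  exact inv_mul_le_one

theorem integrableOn_Ioo_of_memLp_two {R : ℝ} {θ : ℝ → ℝ}
    (hθ : MemLp θ 2 (volume.restrict (Ioo 0 R))) : IntegrableOn θ (Ioo 0 R) :=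
  hθ.integrable one_le_two

theorem integral_abs_Ioo_le {R : ℝ} {θ : ℝ → ℝ}
    (hθ : MemLp θ 2 (volume.restrict (Ioo 0 R))) :
    ∫ s in Ioo 0 R, |θ s| ≤
      (eLpNorm (fun _ => (1 : ℝ)) 2 (volume.restrict (Ioo 0 R))).toReal *
        (eLpNorm θ 2 (volume.restrict (Ioo 0 R))).toReal := by
  have h1 := (memLp_const (μ := volume.restrict (Ioo 0 R)) (p := 2) (1 : ℝ)).abs_integral_mul_le
    hθ.abs
  simp only [one_mul] at h1
  refine (le_abs_self _).trans (h1.trans_eq ?_)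
  congr 2
  exact eLpNorm_norm θ

theorem abs_setIntegral_le_of_subset {R : ℝ} {θ : ℝ → ℝ} (hθ : IntegrableOn θ (Ioo 0 R))
    {s : Set ℝ} (hs : s ⊆ Ioo 0 R) : |∫ t in s, θ t| ≤ ∫ t in Ioo 0 R, |θ t| := by
  refine (abs_integral_le_integral_abs).trans ?_
  exact setIntegral_mono_set hθ.abs (Filter.Eventually.of_forall fun _ => abs_nonneg _)
    (LE.le.eventuallyLE hs)

theorem Ioo_norm_subset {n : ℕ} {R : ℝ} (x : EuclideanSpace ℝ (Fin n)) :
    Ioo ‖x‖ R ⊆ Ioo 0 R := Ioo_subset_Ioo_left (norm_nonneg x)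

theorem abs_radialPotential_le {n : ℕ} {R : ℝ} {θ : ℝ → ℝ} (hθ : IntegrableOn θ (Ioo 0 R))
    (x : EuclideanSpace ℝ (Fin n)) : |radialPotential R θ x| ≤ ∫ t in Ioo 0 R, |θ t| :=
  abs_setIntegral_le_of_subset hθ (Ioo_norm_subset x)

theorem continuous_integral_Ioo_right {R : ℝ} {θ : ℝ → ℝ} (hθ : IntegrableOn θ (Ioo 0 R)) :
    Continuous fun s : ℝ => ∫ t in Ioo (max s 0) R, θ t := by
  set θ' := (Ioo 0 R).indicator θ with hθ'
  have hint : Integrable θ' := (integrable_indicator_iff measurableSet_Ioo).2 hθ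
  have h1 : Continuous fun b => ∫ t in b..R, θ' t := by
    have := intervalIntegral.continuous_primitive (fun a b => hint.intervalIntegrable (a := a)
      (b := b)) R
    exact this.neg.congr fun b => (intervalIntegral.integral_symm _ _).symm
  have h2 : (fun s : ℝ => ∫ t in Ioo (max s 0) R, θ t)
      = fun s => ∫ t in (min (max s 0) R)..R, θ' t := by
    ext s
    have h3 : Ioo (max s 0) R = Ioo (min (max s 0) R) R := by
      rcases le_total (max s 0) R with h | h
      · rw [min_eq_left h]
      · rw [min_eq_right h, Ioo_self, Ioo_eq_empty (not_lt.2 h)]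
    rw [intervalIntegral.integral_of_le (min_le_right _ _), integral_Ioc_eq_integral_Ioo, ← h3]
    refine setIntegral_congr_fun measurableSet_Ioo fun t ht => ?_
    rw [hθ', indicator_of_mem (show t ∈ Ioo 0 R from ⟨(le_max_right _ _).trans_lt ht.1, ht.2⟩)]
  rw [h2]
  exact h1.comp (by fun_prop)

theorem continuous_radialPotential {n : ℕ} {R : ℝ} {θ : ℝ → ℝ} (hθ : IntegrableOn θ (Ioo 0 R)) :
    Continuous (radialPotential (n := n) R θ) := by
  have h1 := (continuous_integral_Ioo_right hθ).comp
    (continuous_norm (E := EuclideanSpace ℝ (Fin n)))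
  refine h1.congr fun x => ?_
  simp [radialPotential]

theorem radialPotential_sub {n : ℕ} {R : ℝ} {θ η : ℝ → ℝ} (hθ : IntegrableOn θ (Ioo 0 R))
    (hη : IntegrableOn η (Ioo 0 R)) (x : EuclideanSpace ℝ (Fin n)) :
    radialPotential R (fun s => θ s - η s) x = radialPotential R θ x - radialPotential R η x :=
  integral_sub (hθ.mono_set (Ioo_norm_subset x)) (hη.mono_set (Ioo_norm_subset x))

theorem hasGradientAt_comp_norm {n : ℕ} {P : ℝ → ℝ} {P' : ℝ} {x : EuclideanSpace ℝ (Fin n)}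
    (hx : x ≠ 0) (hP : HasDerivAt P P' ‖x‖) :
    HasGradientAt (fun y : EuclideanSpace ℝ (Fin n) => P ‖y‖) (P' • (‖x‖⁻¹ • x)) x := by
  have hx0 : ‖x‖ ≠ 0 := norm_ne_zero_iff.2 hx
  have h1 : HasFDerivAt (fun y : EuclideanSpace ℝ (Fin n) => ‖y‖)
      (‖x‖⁻¹ • innerSL ℝ x) x := by
    have h2 := ((hasStrictFDerivAt_norm_sq x).hasFDerivAt).sqrt (by positivity)
    have h3 : (fun y : EuclideanSpace ℝ (Fin n) => √(‖y‖ ^ 2)) = fun y => ‖y‖ := by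
      ext y; exact Real.sqrt_sq (norm_nonneg y)
    rw [h3] at h2
    refine h2.congr_fderiv ?_
    rw [Real.sqrt_sq (norm_nonneg x)]
    ext v
    simp
    field_simp
  rw [hasGradientAt_iff_hasFDerivAt]
  refine (hP.comp_hasFDerivAt x h1).congr_fderiv ?_
  ext v
  simp

theorem IsTestFunction.exists_Icc {R : ℝ} (hR : 0 < R) {η : ℝ → ℝ}
    (hη : IsTestFunction (Ioo 0 R) η) :
    ∃ a b, 0 < a ∧ b < R ∧ ∀ s, s ∉ Icc a b → η s = 0 := by
  rcases (tsupport η).eq_empty_or_nonempty with h | h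
  · refine ⟨R / 2, R / 2, by positivity, by linarith, fun s _ => ?_⟩
    exact image_eq_zero_of_notMem_tsupport (by simp [h])
  · obtain ⟨a, ha⟩ := hη.compact.isCompact.exists_isLeast h
    obtain ⟨b, hb⟩ := hη.compact.isCompact.exists_isGreatest h
    refine ⟨a, b, (hη.support_subset ha.1).1, (hη.support_subset hb.1).2, fun s hs => ?_⟩
    exact image_eq_zero_of_notMem_tsupport fun h' => hs ⟨ha.2 h', hb.2 h'⟩

theorem IsTestFunction.integrable {R : ℝ} {η : ℝ → ℝ} (hη : IsTestFunction (Ioo 0 R) η) :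
    Integrable η :=
  hη.smooth.continuous.integrable_of_hasCompactSupport hη.compact

theorem IsTestFunction.memLp_real {R : ℝ} {η : ℝ → ℝ} (hη : IsTestFunction (Ioo 0 R) η) :
    MemLp η 2 (volume.restrict (Ioo 0 R)) :=
  (hη.smooth.continuous.memLp_of_hasCompactSupport hη.compact).restrict _

/-- As `η` vanishes near `0`, the potential is constant near the origin, where the norm is not
smooth. As `η` vanishes near `R`, the support is compact in the ball. -/
theorem IsTestFunction.radialPotential {n : ℕ} {R : ℝ} (hR : 0 < R) {η : ℝ → ℝ}
    (hη : IsTestFunction (Ioo 0 R) η) :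
    IsTestFunction (ball (0 : EuclideanSpace ℝ (Fin n)) R) (radialPotential R η) ∧
      ∀ x : EuclideanSpace ℝ (Fin n), gradient (NonlocalRadial.radialPotential R η) x
        = radialField η x := by
  obtain ⟨a, b, ha, hb, hab⟩ := hη.exists_Icc hR
  have hηc := hη.smooth.continuous
  set P : ℝ → ℝ := fun s => -∫ t in R..s, η t with hP
  have hPd : ∀ s, HasDerivAt P (-η s) s := fun s =>
    (hηc.integral_hasStrictDerivAt R s).hasDerivAt.neg
  have hPs : ContDiff ℝ ∞ P := by
    rw [contDiff_infty_iff_deriv]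
    refine ⟨fun s => (hPd s).differentiableAt, ?_⟩
    rw [funext fun s => (hPd s).deriv]
    exact hη.smooth.neg
  have heq : NonlocalRadial.radialPotential (n := n) R η = fun x => P ‖x‖ := by
    ext x
    simp only [NonlocalRadial.radialPotential, hP]
    rcases le_total ‖x‖ R with h | h
    · rw [← intervalIntegral.integral_symm, intervalIntegral.integral_of_le h,
        integral_Ioc_eq_integral_Ioo]
    · rw [Ioo_eq_empty (not_lt.2 h), setIntegral_empty, intervalIntegral.integral_of_le h,
        setIntegral_eq_zero_of_forall_eq_zero, neg_zero]
      intro t ht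
      exact hab t fun h' => by linarith [ht.1, h'.2]
  have hnear : ∀ᶠ x in nhds (0 : EuclideanSpace ℝ (Fin n)),
      NonlocalRadial.radialPotential R η x = NonlocalRadial.radialPotential (n := n) R η 0 := by
    filter_upwards [ball_mem_nhds (0 : EuclideanSpace ℝ (Fin n)) ha] with x hx
    have hx' := mem_ball_zero_iff.1 hx
    simp only [NonlocalRadial.radialPotential, norm_zero]
    refine (setIntegral_eq_of_subset_of_forall_sdiff_eq_zero measurableSet_Ioo
      (Ioo_norm_subset x) fun t ht => hab t fun h' => ?_).symm
    exact ht.2 ⟨by linarith [h'.1], ht.1.2⟩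
  have hzero : ∀ x : EuclideanSpace ℝ (Fin n), x ∉ closedBall 0 b →
      NonlocalRadial.radialPotential R η x = 0 := by
    intro x hx
    have hx' : b < ‖x‖ := by simpa using hx
    refine setIntegral_eq_zero_of_forall_eq_zero fun t ht => hab t fun h' => ?_
    linarith [ht.1, h'.2]
  refine ⟨⟨?_, ?_, ?_⟩, ?_⟩
  · rw [contDiff_iff_contDiffAt]
    intro x
    rcases eq_or_ne x 0 with rfl | hx
    · exact contDiffAt_const.congr_of_eventuallyEq hnear
    · rw [heq]
      exact hPs.contDiffAt.comp x (contDiffAt_norm ℝ hx)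
  · exact HasCompactSupport.intro (isCompact_closedBall 0 b) hzero
  · refine (closure_minimal (fun x hx => ?_) isClosed_closedBall).trans
      (closedBall_subset_ball hb)
    by_contra h
    exact hx (hzero x h)
  · intro x
    rcases eq_or_ne x 0 with rfl | hx
    · rw [Filter.EventuallyEq.gradient_eq hnear, gradient_fun_const]
      simp [radialField]
    · rw [heq, (hasGradientAt_comp_norm hx (hPd ‖x‖)).gradient, radialField, neg_smul]

theorem radialField_sub {n : ℕ} (θ η : ℝ → ℝ) (x : EuclideanSpace ℝ (Fin n)) :
    radialField (fun s => θ s - η s) x = radialField θ x - radialField η x := by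
  simp only [radialField, sub_smul]; abel

theorem aestronglyMeasurable_radialField {n : ℕ} (hn : 0 < n) {R : ℝ} {θ : ℝ → ℝ}
    (hθ : AEStronglyMeasurable θ (volume.restrict (Ioo 0 R))) :
    AEStronglyMeasurable (radialField (n := n) θ) (volume.restrict (ball 0 R)) := by
  have h1 : AEStronglyMeasurable (fun x : EuclideanSpace ℝ (Fin n) => θ ‖x‖)
      (volume.restrict (ball 0 R)) :=
    hθ.comp_quasiMeasurePreserving (quasiMeasurePreserving_norm_ball hn R)
  have h2 : Measurable fun x : EuclideanSpace ℝ (Fin n) => ‖x‖⁻¹ • x :=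
    measurable_norm.inv.smul measurable_id
  exact (h1.smul h2.aestronglyMeasurable).neg

/-- Test functions `η` close to `θ` in `L²(0, R)` have potentials that are test functions of the
ball. The gradients converge by the transfer estimate and the potentials uniformly, so no trace
theory is needed for the boundary condition. -/
theorem memH01_radialPotential {n : ℕ} (hn : 0 < n) {R : ℝ} (hR : 0 < R) {θ : ℝ → ℝ}
    (hθ : MemLp θ 2 (volume.restrict (Ioo 0 R))) :
    MemH01 (ball (0 : EuclideanSpace ℝ (Fin n)) R) (radialPotential R θ) (radialField θ) := by
  set Ω : Set (EuclideanSpace ℝ (Fin n)) := ball 0 R with hΩ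
  have : IsFiniteMeasure (volume.restrict Ω) := ⟨by
    rw [Measure.restrict_apply_univ]; exact measure_ball_lt_top⟩
  obtain ⟨C, hC, hCle⟩ := exists_eLpNorm_comp_norm_le hn R
  have hθi := integrableOn_Ioo_of_memLp_two hθ
  have hfield : ∀ ζ : ℝ → ℝ, AEStronglyMeasurable ζ (volume.restrict (Ioo 0 R)) →
      eLpNorm (radialField (n := n) ζ) 2 (volume.restrict Ω) ≤
        C * eLpNorm ζ 2 (volume.restrict (Ioo 0 R)) := fun ζ hζ =>
    (eLpNorm_mono fun x => norm_radialField_le ζ x).trans (hCle ζ hζ)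
  refine MemH01.of_isH1Limit ?_ ?_ ?_
  · refine MemLp.of_bound (continuous_radialPotential hθi).aestronglyMeasurable
      (∫ t in Ioo 0 R, |θ t|) (Filter.Eventually.of_forall fun x => ?_)
    exact abs_radialPotential_le hθi x
  · refine ⟨aestronglyMeasurable_radialField hn hθ.1, (hfield θ hθ.1).trans_lt ?_⟩
    exact ENNReal.mul_lt_top hC.lt_top hθ.2
  · intro ε hε
    set V : ℝ≥0∞ := (volume.restrict Ω) univ ^ (2 : ℝ≥0∞).toReal⁻¹ with hV
    have hVfin : V ≠ ⊤ := by
      refine ENNReal.rpow_ne_top_of_nonneg (by simp) (measure_ne_top _ _)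
    set B : ℝ := (eLpNorm (fun _ => (1 : ℝ)) 2 (volume.restrict (Ioo 0 R))).toReal with hB
    have hB0 : 0 ≤ B := ENNReal.toReal_nonneg
    -- `V` turns a uniform bound into an `L²` bound, `B` turns the `L²` norm of a profile into an
    -- `L¹` bound, and `C` compares fields with profiles.
    set M : ℝ≥0∞ := V * ENNReal.ofReal B + C with hM
    have hMfin : M ≠ ⊤ := by
      rw [hM]; exact ENNReal.add_ne_top.2 ⟨ENNReal.mul_ne_top hVfin ENNReal.ofReal_ne_top, hC⟩
    obtain ⟨δ, hδ, hδM⟩ : ∃ δ : ℝ, 0 < δ ∧ M * ENNReal.ofReal δ < ε := by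
      have h1 : Filter.Tendsto (fun δ : ℝ => M * ENNReal.ofReal δ) (nhdsWithin 0 (Ioi 0))
          (nhds 0) := by
        have h2 : Filter.Tendsto (fun δ : ℝ => M * ENNReal.ofReal δ) (nhds 0)
            (nhds (M * ENNReal.ofReal 0)) :=
          ENNReal.Tendsto.const_mul (ENNReal.continuous_ofReal.tendsto 0) (Or.inr hMfin)
        rw [ENNReal.ofReal_zero, mul_zero] at h2
        exact h2.mono_left nhdsWithin_le_nhds
      obtain ⟨δ, h3, h4⟩ := ((h1.eventually_lt_const hε).and eventually_mem_nhdsWithin).exists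
      exact ⟨δ, h4, h3⟩
    obtain ⟨η, hη, hηδ⟩ := exists_isTestFunction_Ioo_eLpNorm_sub_le hR hθ hδ
    have hd : MemLp (fun s => θ s - η s) 2 (volume.restrict (Ioo 0 R)) := hθ.sub hη.memLp_real
    obtain ⟨hψ, hgrad⟩ := hη.radialPotential (n := n) hR
    refine ⟨_, hψ, ?_, ?_⟩
    · have h1 : ∀ x : EuclideanSpace ℝ (Fin n),
          ‖radialPotential R θ x - radialPotential R η x‖ ≤ B * δ := by
        intro x
        rw [← radialPotential_sub hθi hη.integrable.integrableOn]
        refine (abs_radialPotential_le (integrableOn_Ioo_of_memLp_two hd) x).trans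
          ((integral_abs_Ioo_le hd).trans ?_)
        gcongr
        exact ENNReal.toReal_le_of_le_ofReal hδ.le hηδ
      refine lt_of_le_of_lt ?_ hδM
      refine (eLpNorm_le_of_ae_bound (Filter.Eventually.of_forall h1)).trans ?_
      rw [ENNReal.ofReal_mul hB0, ← mul_assoc]
      gcongr
      exact le_self_add
    · simp only [hgrad, ← radialField_sub]
      refine lt_of_le_of_lt ((hfield _ hd.1).trans ?_) hδM
      gcongr
      exact le_add_self

/-! ### The flux of a radial source and the weak equation -/

/-- The function `w` with `(s^{n-1} w)' = s^{n-1} p` and `(s^{n-1} w)(0) = 0`. -/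
noncomputable def radialFlux (n : ℕ) (p : ℝ → ℝ) (s : ℝ) : ℝ :=
  (∫ t in Ioo 0 s, t ^ (n - 1) * p t) / s ^ (n - 1)

theorem integrableOn_pow_mul {R : ℝ} {p : ℝ → ℝ} (hp : IntegrableOn p (Ioo 0 R)) (k : ℕ) :
    IntegrableOn (fun t => t ^ k * p t) (Ioo 0 R) := by
  refine Integrable.bdd_mul (c := R ^ k) hp (by fun_prop) ?_
  refine (ae_restrict_iff' measurableSet_Ioo).2 (Filter.Eventually.of_forall fun t ht => ?_)
  rw [Real.norm_eq_abs, abs_of_nonneg (pow_nonneg ht.1.le k)]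
  exact pow_le_pow_left₀ ht.1.le ht.2.le k

/-- The ratio `(t/s)^(n-1)` is at most `1` for `0 < t < s`, so dividing by `s^(n-1)` creates no
singularity at `0`. -/
theorem abs_radialFlux_le (n : ℕ) {R : ℝ} {p : ℝ → ℝ} (hp : IntegrableOn p (Ioo 0 R)) {s : ℝ}
    (hs : s ∈ Ioo 0 R) : |radialFlux n p s| ≤ ∫ t in Ioo 0 R, |p t| := by
  have hsub : Ioo 0 s ⊆ Ioo 0 R := Ioo_subset_Ioo_right hs.2.le
  have hspos : 0 < s ^ (n - 1) := pow_pos hs.1 _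
  rw [radialFlux, abs_div, abs_of_pos hspos, div_le_iff₀ hspos]
  calc |∫ t in Ioo 0 s, t ^ (n - 1) * p t| ≤ ∫ t in Ioo 0 s, |t ^ (n - 1) * p t| :=
        abs_integral_le_integral_abs
    _ ≤ ∫ t in Ioo 0 s, |p t| * s ^ (n - 1) := by
        refine setIntegral_mono_on ((integrableOn_pow_mul hp _).mono_set hsub).abs
          ((hp.mono_set hsub).abs.mul_const _) measurableSet_Ioo fun t ht => ?_
        rw [abs_mul, abs_of_nonneg (pow_nonneg ht.1.le _), mul_comm]
        gcongr
        · exact ht.1.le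
        · exact ht.2.le
    _ = (∫ t in Ioo 0 s, |p t|) * s ^ (n - 1) := integral_mul_const _ _
    _ ≤ _ := by
        exact mul_le_mul_of_nonneg_right (setIntegral_mono_set hp.abs
          (Filter.Eventually.of_forall fun _ => abs_nonneg _) (LE.le.eventuallyLE hsub)) hspos.le

theorem radialFlux_nonneg (n : ℕ) {p : ℝ → ℝ} (hp : ∀ s, 0 ≤ p s) {s : ℝ} (hs : 0 ≤ s) :
    0 ≤ radialFlux n p s := by
  refine div_nonneg (setIntegral_nonneg measurableSet_Ioo fun t ht => ?_) (pow_nonneg hs _)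
  exact mul_nonneg (pow_nonneg ht.1.le _) (hp t)

theorem aestronglyMeasurable_radialFlux (n : ℕ) {R : ℝ} {p : ℝ → ℝ}
    (hp : IntegrableOn p (Ioo 0 R)) :
    AEStronglyMeasurable (radialFlux n p) (volume.restrict (Ioo 0 R)) := by
  set q' := (Ioo 0 R).indicator (fun t => t ^ (n - 1) * p t) with hq'
  have hint : Integrable q' :=
    (integrable_indicator_iff measurableSet_Ioo).2 (integrableOn_pow_mul hp _)
  have h1 : Continuous fun b => ∫ t in 0..b, q' t :=
    intervalIntegral.continuous_primitive (fun a b => hint.intervalIntegrable) 0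
  have h2 : Measurable fun s : ℝ => (∫ t in 0..s, q' t) / s ^ (n - 1) :=
    h1.measurable.div (by fun_prop)
  refine h2.aestronglyMeasurable.congr ?_
  refine (ae_restrict_iff' measurableSet_Ioo).2 (Filter.Eventually.of_forall fun s hs => ?_)
  simp only [radialFlux]
  rw [intervalIntegral.integral_of_le hs.1.le, integral_Ioc_eq_integral_Ioo]
  congr 1
  refine setIntegral_congr_fun measurableSet_Ioo fun t ht => ?_
  rw [hq', indicator_of_mem (show t ∈ Ioo 0 R from ⟨ht.1, ht.2.trans hs.2⟩)]

theorem radialFlux_sub (n : ℕ) {R : ℝ} {p q : ℝ → ℝ} (hp : IntegrableOn p (Ioo 0 R))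
    (hq : IntegrableOn q (Ioo 0 R)) {s : ℝ} (hs : s ≤ R) :
    radialFlux n (fun t => p t - q t) s = radialFlux n p s - radialFlux n q s := by
  have hsub : Ioo 0 s ⊆ Ioo 0 R := Ioo_subset_Ioo_right hs
  simp only [radialFlux, mul_sub]
  rw [integral_sub ((integrableOn_pow_mul hp _).mono_set hsub)
    ((integrableOn_pow_mul hq _).mono_set hsub), sub_div]

theorem memLp_radialFlux (n : ℕ) {R : ℝ} {p : ℝ → ℝ} (hp : IntegrableOn p (Ioo 0 R)) :
    MemLp (radialFlux n p) 2 (volume.restrict (Ioo 0 R)) := by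
  refine MemLp.of_bound (aestronglyMeasurable_radialFlux n hp) (∫ t in Ioo 0 R, |p t|) ?_
  exact (ae_restrict_iff' measurableSet_Ioo).2
    (Filter.Eventually.of_forall fun s hs => abs_radialFlux_le n hp hs)

theorem sum_coord_mul_clm_apply {n : ℕ} (L : EuclideanSpace ℝ (Fin n) →L[ℝ] ℝ)
    (x : EuclideanSpace ℝ (Fin n)) : ∑ i, x i * L (EuclideanSpace.single i 1) = L x := by
  have h1 := (EuclideanSpace.basisFun (Fin n) ℝ).sum_repr x
  conv_rhs => rw [← h1, map_sum]
  simp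

/-- Integration by parts for the vector field `m(x) x`. -/
theorem integral_mul_fderiv_apply_self {n : ℕ} {m ψ : EuclideanSpace ℝ (Fin n) → ℝ}
    (hm : ContDiff ℝ 1 m) (hψ : ContDiff ℝ 1 ψ) (hψc : HasCompactSupport ψ) :
    ∫ x, m x * fderiv ℝ ψ x x = - ∫ x, (n * m x + fderiv ℝ m x x) * ψ x := by
  have hcoord : ∀ (i : Fin n) (x : EuclideanSpace ℝ (Fin n)),
      HasFDerivAt (fun y : EuclideanSpace ℝ (Fin n) => y i)
        (EuclideanSpace.proj i : EuclideanSpace ℝ (Fin n) →L[ℝ] ℝ) x := fun i x =>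
    (EuclideanSpace.proj i : EuclideanSpace ℝ (Fin n) →L[ℝ] ℝ).hasFDerivAt
  have hci : ∀ i : Fin n, Continuous fun x : EuclideanSpace ℝ (Fin n) => x i := fun i =>
    (EuclideanSpace.proj i : EuclideanSpace ℝ (Fin n) →L[ℝ] ℝ).continuous
  have hmd : Differentiable ℝ m := hm.differentiable one_ne_zero
  have hψd : Differentiable ℝ ψ := hψ.differentiable one_ne_zero
  have hmc : ∀ i : Fin n, Continuous fun x => fderiv ℝ m x (EuclideanSpace.single i 1) := fun i =>
    (hm.continuous_fderiv one_ne_zero).clm_apply continuous_const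
  have hψdc : ∀ i : Fin n, Continuous fun x => fderiv ℝ ψ x (EuclideanSpace.single i 1) := fun i =>
    (hψ.continuous_fderiv one_ne_zero).clm_apply continuous_const
  have hψsupp : ∀ i : Fin n,
      HasCompactSupport fun x => fderiv ℝ ψ x (EuclideanSpace.single i 1) := fun i =>
    hψc.fderiv_apply ℝ _
  have hd : ∀ (i : Fin n) (x : EuclideanSpace ℝ (Fin n)),
      fderiv ℝ (fun y => m y * y i) x (EuclideanSpace.single i 1)
        = m x + x i * fderiv ℝ m x (EuclideanSpace.single i 1) := by
    intro i x
    have h1 : HasFDerivAt (fun y => m y * y i) _ x := (hmd x).hasFDerivAt.mul (hcoord i x)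
    rw [h1.fderiv]
    simp
  have hint1 : ∀ i : Fin n, Integrable fun x : EuclideanSpace ℝ (Fin n) =>
      (m x * x i) * fderiv ℝ ψ x (EuclideanSpace.single i 1) := fun i =>
    ((hm.continuous.mul (hci i)).mul (hψdc i)).integrable_of_hasCompactSupport (hψsupp i).mul_left
  have hint2 : ∀ i : Fin n, Integrable fun x : EuclideanSpace ℝ (Fin n) =>
      (m x + x i * fderiv ℝ m x (EuclideanSpace.single i 1)) * ψ x := fun i =>
    ((hm.continuous.add ((hci i).mul (hmc i))).mul
      hψ.continuous).integrable_of_hasCompactSupport hψc.mul_left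
  have hparts : ∀ i : Fin n,
      ∫ x : EuclideanSpace ℝ (Fin n), (m x * x i) * fderiv ℝ ψ x (EuclideanSpace.single i 1)
        = - ∫ x, (m x + x i * fderiv ℝ m x (EuclideanSpace.single i 1)) * ψ x := by
    intro i
    simp only [← hd]
    refine integral_mul_fderiv_eq_neg_fderiv_mul_of_integrable ?_ (hint1 i) ?_
      (fun x _ => (hmd x).mul (hcoord i x).differentiableAt) (fun x _ => hψd x)
    · simp only [hd]; exact hint2 i
    · exact ((hm.continuous.mul (hci i)).mul hψ.continuous).integrable_of_hasCompactSupport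
        hψc.mul_left
  calc ∫ x, m x * fderiv ℝ ψ x x
      = ∫ x, ∑ i, (m x * x i) * fderiv ℝ ψ x (EuclideanSpace.single i 1) := by
        congr 1; ext x
        rw [← sum_coord_mul_clm_apply (fderiv ℝ ψ x) x, Finset.mul_sum]
        exact Finset.sum_congr rfl fun i _ => by ring
    _ = ∑ i, - ∫ x, (m x + x i * fderiv ℝ m x (EuclideanSpace.single i 1)) * ψ x := by
        rw [integral_finsetSum _ fun i _ => hint1 i]
        exact Finset.sum_congr rfl fun i _ => hparts i
    _ = - ∫ x, ∑ i, (m x + x i * fderiv ℝ m x (EuclideanSpace.single i 1)) * ψ x := by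
        rw [integral_finsetSum _ fun i _ => hint2 i, Finset.sum_neg_distrib]
    _ = _ := by
        congr 2; ext x
        rw [← Finset.sum_mul, Finset.sum_add_distrib, sum_coord_mul_clm_apply (fderiv ℝ m x) x]
        simp

/-- The field is `m(x) x` with `m = -Q(‖x‖)/‖x‖^n` and `Q' = s^(n-1) η`. Since `η` vanishes near
`0`, so does `m`, which is therefore `C¹`, and the divergence `n m + Dm(x) x` is exactly `-η(‖x‖)`.
-/
theorem integral_inner_radialField_of_smooth {n : ℕ} (hn : 0 < n) {R : ℝ} (hR : 0 < R) {η : ℝ → ℝ}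
    (hη : IsTestFunction (Ioo 0 R) η) {ψ : EuclideanSpace ℝ (Fin n) → ℝ}
    (hψ : IsTestFunction (ball 0 R) ψ) :
    ∫ x in ball 0 R, inner ℝ (radialField (radialFlux n η) x) (gradient ψ x) =
      ∫ x in ball 0 R, η ‖x‖ * ψ x := by
  obtain ⟨a, b, ha, hb, hab⟩ := hη.exists_Icc hR
  have hηc := hη.smooth.continuous
  set Q : ℝ → ℝ := fun s => ∫ t in 0..s, t ^ (n - 1) * η t with hQ
  have hqc : Continuous fun t => t ^ (n - 1) * η t := by fun_prop
  have hQd : ∀ s, HasDerivAt Q (s ^ (n - 1) * η s) s := fun s =>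
    (hqc.integral_hasStrictDerivAt 0 s).hasDerivAt
  have hQs : ContDiff ℝ ∞ Q := by
    rw [contDiff_infty_iff_deriv]
    refine ⟨fun s => (hQd s).differentiableAt, ?_⟩
    rw [funext fun s => (hQd s).deriv]
    exact (contDiff_id.pow _).mul hη.smooth
  have hQ0 : ∀ s, 0 ≤ s → s < a → Q s = 0 := by
    intro s hs0 hsa
    simp only [hQ]
    rw [intervalIntegral.integral_of_le hs0]
    refine setIntegral_eq_zero_of_forall_eq_zero fun t ht => ?_
    rw [hab t fun h' => by linarith [ht.2, h'.1], mul_zero]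
  set F : ℝ → ℝ := fun s => -(Q s / s ^ n) with hF
  have hFd : ∀ s, 0 < s → HasDerivAt F (-(η s / s) + n * Q s / s ^ (n + 1)) s := by
    intro s hs
    have h1 := ((hQd s).div (hasDerivAt_pow n s) (pow_pos hs n).ne').neg
    refine h1.congr_deriv ?_
    obtain ⟨k, rfl⟩ : ∃ k, n = k + 1 := ⟨n - 1, by omega⟩
    simp only [Nat.add_sub_cancel]
    field_simp
    ring
  set m : EuclideanSpace ℝ (Fin n) → ℝ := fun x => F ‖x‖ with hm
  have hnear : ∀ᶠ x in nhds (0 : EuclideanSpace ℝ (Fin n)), m x = 0 := by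
    filter_upwards [ball_mem_nhds (0 : EuclideanSpace ℝ (Fin n)) ha] with x hx
    simp only [hm, hF]
    rw [hQ0 _ (norm_nonneg x) (mem_ball_zero_iff.1 hx), zero_div, neg_zero]
  have hms : ContDiff ℝ 1 m := by
    rw [contDiff_iff_contDiffAt]
    intro x
    rcases eq_or_ne x 0 with rfl | hx
    · exact contDiffAt_const.congr_of_eventuallyEq hnear
    · have h1 : ContDiffAt ℝ 1 F ‖x‖ :=
        ((hQs.of_le (by simp)).contDiffAt.div (contDiff_id.pow n).contDiffAt
          (pow_pos (norm_pos_iff.2 hx) n).ne').neg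
      exact h1.comp x (contDiffAt_norm ℝ hx)
  have hdiv : ∀ x, n * m x + fderiv ℝ m x x = - η ‖x‖ := by
    intro x
    rcases eq_or_ne x 0 with rfl | hx
    · rw [hnear.self_of_nhds, map_zero, norm_zero, hab 0 fun h' => by linarith [h'.1]]
      simp
    · have hpos := norm_pos_iff.2 hx
      rw [(hasGradientAt_comp_norm hx (hFd ‖x‖ hpos)).fderiv_apply, inner_smul_left,
        inner_smul_left, real_inner_self_eq_norm_sq]
      simp only [hm, hF, conj_trivial]
      field_simp
      ring
  have hfield : ∀ x, radialField (radialFlux n η) x = m x • x := by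
    intro x
    simp only [radialField, radialFlux, hm, hF, hQ]
    rw [intervalIntegral.integral_of_le (norm_nonneg x), integral_Ioc_eq_integral_Ioo, smul_smul,
      ← neg_smul]
    congr 2
    obtain ⟨k, rfl⟩ : ∃ k, n = k + 1 := ⟨n - 1, by omega⟩
    rw [Nat.add_sub_cancel, pow_succ, div_mul_eq_div_div, div_eq_mul_inv _ ‖x‖]
  rw [setIntegral_eq_integral_of_forall_compl_eq_zero
    (fun x hx => by rw [hψ.gradient_eq_zero_of_notMem hx, inner_zero_right]),
    setIntegral_eq_integral_of_forall_compl_eq_zero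
    (fun x hx => by rw [hψ.eq_zero_of_notMem hx, mul_zero])]
  have h1 := integral_mul_fderiv_apply_self hms (hψ.smooth.of_le (by simp)) hψ.compact
  simp only [hdiv, neg_mul, integral_neg, neg_neg] at h1
  rw [← h1]
  congr 1
  ext x
  rw [hfield, inner_smul_left, real_inner_comm, inner_gradient_left]
  simp

/-- The field `-w(‖x‖) x/‖x‖`, with `w` the flux of `p`, has divergence `-p(‖x‖)`. -/
theorem integral_inner_radialField {n : ℕ} (hn : 0 < n) {R : ℝ} (hR : 0 < R) {p : ℝ → ℝ}
    (hp : MemLp p 2 (volume.restrict (Ioo 0 R))) {ψ : EuclideanSpace ℝ (Fin n) → ℝ}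
    (hψ : IsTestFunction (ball 0 R) ψ) :
    ∫ x in ball 0 R, inner ℝ (radialField (radialFlux n p) x) (gradient ψ x) =
      ∫ x in ball 0 R, p ‖x‖ * ψ x := by
  set Ω : Set (EuclideanSpace ℝ (Fin n)) := ball 0 R with hΩ
  obtain ⟨C, hC, hCle⟩ := exists_eLpNorm_comp_norm_le hn R
  have hcomp : ∀ q : ℝ → ℝ, MemLp q 2 (volume.restrict (Ioo 0 R)) →
      MemLp (fun x : EuclideanSpace ℝ (Fin n) => q ‖x‖) 2 (volume.restrict Ω) := fun q hq =>
    ⟨hq.1.comp_quasiMeasurePreserving (quasiMeasurePreserving_norm_ball hn R),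
      (hCle q hq.1).trans_lt (ENNReal.mul_lt_top hC.lt_top hq.2)⟩
  have hpi := integrableOn_Ioo_of_memLp_two hp
  set B : ℝ := (eLpNorm (fun _ => (1 : ℝ)) 2 (volume.restrict (Ioo 0 R))).toReal with hB
  have hB0 : 0 ≤ B := ENNReal.toReal_nonneg
  -- One factor `B` bounds the `L¹` norm of `q` by its `L²` norm; the other bounds the `L²` norm of
  -- the flux by its supremum. `C` passes to the ball.
  refine eq_of_forall_abs_sub_le_mul (C := C.toReal * (B * B) *
    (eLpNorm (gradient ψ) 2 (volume.restrict Ω)).toReal +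
    C.toReal * (eLpNorm ψ 2 (volume.restrict Ω)).toReal) fun ε hε => ?_
  obtain ⟨η, hη, hηε⟩ := exists_isTestFunction_Ioo_eLpNorm_sub_le hR hp hε
  have hηi : IntegrableOn η (Ioo 0 R) := hη.integrable.integrableOn
  set q : ℝ → ℝ := fun s => p s - η s with hq
  have hqL : MemLp q 2 (volume.restrict (Ioo 0 R)) := hp.sub hη.memLp_real
  have hqi := integrableOn_Ioo_of_memLp_two hqL
  have hfL : ∀ r : ℝ → ℝ, IntegrableOn r (Ioo 0 R) →
      MemLp (radialField (n := n) (radialFlux n r)) 2 (volume.restrict Ω) := fun r hr =>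
    (memH01_radialPotential hn hR (memLp_radialFlux n hr)).memLp_grad
  have e1 : (∫ x in Ω, inner ℝ (radialField (radialFlux n p) x) (gradient ψ x)) -
        ∫ x in Ω, p ‖x‖ * ψ x
      = (∫ x in Ω, inner ℝ (radialField (radialFlux n q) x) (gradient ψ x)) -
        ∫ x in Ω, q ‖x‖ * ψ x := by
    have h1 : ∫ x in Ω, inner ℝ (radialField (radialFlux n q) x) (gradient ψ x)
        = (∫ x in Ω, inner ℝ (radialField (radialFlux n p) x) (gradient ψ x)) -
          ∫ x in Ω, inner ℝ (radialField (radialFlux n η) x) (gradient ψ x) := by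
      rw [← integral_sub ((hfL p hpi).integrable_inner_two hψ.memLp_gradient)
        ((hfL η hηi).integrable_inner_two hψ.memLp_gradient)]
      refine setIntegral_congr_fun measurableSet_ball fun x hx => ?_
      have h2 : radialFlux n q ‖x‖ = radialFlux n p ‖x‖ - radialFlux n η ‖x‖ :=
        radialFlux_sub n hpi hηi (mem_ball_zero_iff.1 hx).le
      have h3 : radialField (radialFlux n q) x
          = radialField (radialFlux n p) x - radialField (radialFlux n η) x := by
        simp only [radialField, h2, sub_smul]; abel
      simp only [h3, inner_sub_left]
    have h4 : ∫ x in Ω, q ‖x‖ * ψ x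
        = (∫ x in Ω, p ‖x‖ * ψ x) - ∫ x in Ω, η ‖x‖ * ψ x := by
      rw [← integral_sub ((hcomp p hp).integrable_mul_two hψ.memLp)
        ((hcomp η hη.memLp_real).integrable_mul_two hψ.memLp)]
      simp only [hq, sub_mul]
    rw [h1, h4, integral_inner_radialField_of_smooth hn hR hη hψ]
    ring
  have hqε : (eLpNorm q 2 (volume.restrict (Ioo 0 R))).toReal ≤ ε :=
    ENNReal.toReal_le_of_le_ofReal hε.le hηε
  have hflux : (eLpNorm (radialFlux n q) 2 (volume.restrict (Ioo 0 R))).toReal ≤ B * B * ε := by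
    have h1 : eLpNorm (radialFlux n q) 2 (volume.restrict (Ioo 0 R)) ≤
        ENNReal.ofReal (∫ t in Ioo 0 R, |q t|) *
          eLpNorm (fun _ => (1 : ℝ)) 2 (volume.restrict (Ioo 0 R)) := by
      refine eLpNorm_le_mul_eLpNorm_of_ae_le_mul ?_ 2
      refine (ae_restrict_iff' measurableSet_Ioo).2 (Filter.Eventually.of_forall fun s hs => ?_)
      simpa using abs_radialFlux_le n hqi hs
    have h2 := ENNReal.toReal_mono (ENNReal.mul_ne_top ENNReal.ofReal_ne_top
      (memLp_const (1 : ℝ)).eLpNorm_ne_top) h1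
    rw [ENNReal.toReal_mul, ENNReal.toReal_ofReal (integral_nonneg fun _ => abs_nonneg _)] at h2
    refine h2.trans ?_
    have h3 := (integral_abs_Ioo_le hqL).trans (mul_le_mul_of_nonneg_left hqε hB0)
    calc _ ≤ (B * ε) * B := by gcongr
      _ = _ := by ring
  have hfield : (eLpNorm (radialField (n := n) (radialFlux n q)) 2 (volume.restrict Ω)).toReal ≤
      C.toReal * (B * B * ε) := by
    have h1 := (eLpNorm_mono fun x => norm_radialField_le (radialFlux n q) x).trans
      (hCle _ (memLp_radialFlux n hqi).1)
    have h2 := ENNReal.toReal_mono (ENNReal.mul_ne_top hC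
      (memLp_radialFlux n hqi).eLpNorm_ne_top) h1
    rw [ENNReal.toReal_mul] at h2
    exact h2.trans (by gcongr)
  have hqn : (eLpNorm (fun x : EuclideanSpace ℝ (Fin n) => q ‖x‖) 2 (volume.restrict Ω)).toReal ≤
      C.toReal * ε := by
    have h2 := ENNReal.toReal_mono (ENNReal.mul_ne_top hC hqL.eLpNorm_ne_top) (hCle _ hqL.1)
    rw [ENNReal.toReal_mul] at h2
    exact h2.trans (by gcongr)
  rw [e1]
  refine (abs_sub _ _).trans ?_
  have h5 := (hfL q hqi).abs_integral_inner_le hψ.memLp_gradient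
  have h6 := (hcomp q hqL).abs_integral_mul_le hψ.memLp
  calc _ ≤ C.toReal * (B * B * ε) * (eLpNorm (gradient ψ) 2 (volume.restrict Ω)).toReal +
        C.toReal * ε * (eLpNorm ψ 2 (volume.restrict Ω)).toReal := by
        refine add_le_add (h5.trans ?_) (h6.trans ?_) <;> gcongr
    _ = _ := by ring

/-- Radial potentials solve radial elliptic equations: `A ∇u = ∇φ` with `-Δφ = p(‖x‖)`. -/
theorem isWeakSolution_radialPotential {n : ℕ} (hn : 0 < n) {R : ℝ} (hR : 0 < R) {p θ : ℝ → ℝ}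
    (hp : MemLp p 2 (volume.restrict (Ioo 0 R))) (hθ : MemLp θ 2 (volume.restrict (Ioo 0 R)))
    {A f : EuclideanSpace ℝ (Fin n) → ℝ} (hf : MemLp f 2 (volume.restrict (ball 0 R)))
    (hfp : ∀ᵐ x ∂volume.restrict (ball (0 : EuclideanSpace ℝ (Fin n)) R), f x = p ‖x‖)
    (hA : ∀ x ∈ ball (0 : EuclideanSpace ℝ (Fin n)) R, A x * θ ‖x‖ = radialFlux n p ‖x‖) :
    IsWeakSolution (ball 0 R) A f (radialPotential R θ) := by
  refine ⟨radialField θ, memH01_radialPotential hn hR hθ, fun v H hv => ?_⟩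
  have hpi := integrableOn_Ioo_of_memLp_two hp
  have h1 := integral_inner_eq_of_isH1Limit hv.memLp hv.memLp_grad hv.approx hf
    (memH01_radialPotential hn hR (memLp_radialFlux n hpi)).memLp_grad (fun ψ hψ => by
      rw [integral_inner_radialField hn hR hp hψ]
      refine integral_congr_ae ?_
      filter_upwards [hfp] with x hx
      rw [hx])
  rw [← h1]
  -- By `hA` the vector `A ∇u` is pointwise the field of the flux of `p`, so no ellipticity or
  -- regularity of `A` is involved.
  refine setIntegral_congr_fun measurableSet_ball fun x hx => ?_
  simp only [radialField, inner_neg_left, inner_smul_left, conj_trivial]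
  rw [← hA x hx]
  ring

/-! ### Continuity, monotonicity and symmetry of `l_r` -/

section Nonlocal

variable {n : ℕ} {Ω : Set (EuclideanSpace ℝ (Fin n))} {g u v : EuclideanSpace ℝ (Fin n) → ℝ}
  {r M : ℝ} {x : EuclideanSpace ℝ (Fin n)}

theorem lr_eq_setIntegral_indicator (x : EuclideanSpace ℝ (Fin n)) :
    lr Ω g r u x =
      ∫ y in Ω, (closedBall x r).indicator (fun _ => (1 : ℝ)) y * (g y * u y) := by
  rw [lr, ← setIntegral_indicator measurableSet_closedBall]
  congr 1
  ext y
  by_cases hy : y ∈ closedBall x r <;> simp [hy]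

theorem abs_indicator_sub_le (s t : Set (EuclideanSpace ℝ (Fin n)))
    (y : EuclideanSpace ℝ (Fin n)) :
    |s.indicator (fun _ => (1 : ℝ)) y - t.indicator (fun _ => (1 : ℝ)) y| ≤ 1 := by
  by_cases h1 : y ∈ s <;> by_cases h2 : y ∈ t <;> simp [h1, h2]

/-- Off the sphere of radius `r` around `x`, a null set, the indicators agree once `x'` is near `x`;
`|g|` dominates. This modulus does not involve `u`, which makes `l_r(u)` equicontinuous over bounded
families. -/
theorem tendsto_integral_abs_indicator_sub (hn : 0 < n) (hg : IntegrableOn g Ω)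
    (x : EuclideanSpace ℝ (Fin n)) :
    Filter.Tendsto (fun x' => ∫ y in Ω, |(closedBall x r).indicator (fun _ => (1 : ℝ)) y -
      (closedBall x' r).indicator (fun _ => (1 : ℝ)) y| * |g y|) (nhds x) (nhds 0) := by
  have : Nonempty (Fin n) := ⟨⟨0, hn⟩⟩
  have hm : ∀ z : EuclideanSpace ℝ (Fin n),
      Measurable ((closedBall z r).indicator (fun _ => (1 : ℝ))) := fun z =>
    measurable_const.indicator measurableSet_closedBall
  have h0 : (∫ _ in Ω, (0 : ℝ)) = 0 := integral_zero _ _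
  rw [← h0]
  refine tendsto_integral_filter_of_dominated_convergence (fun y => |g y|)
    (Filter.Eventually.of_forall fun x' => ?_) (Filter.Eventually.of_forall fun x' => ?_)
    hg.abs ?_
  · exact ((hm x).sub (hm x')).abs.aestronglyMeasurable.mul hg.1.norm
  · refine Filter.Eventually.of_forall fun y => ?_
    rw [Real.norm_eq_abs, abs_mul, abs_abs, abs_abs]
    exact mul_le_of_le_one_left (abs_nonneg _) (abs_indicator_sub_le _ _ y)
  · have hs : ∀ᵐ y ∂(volume : Measure (EuclideanSpace ℝ (Fin n))), y ∉ sphere x r :=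
      measure_eq_zero_iff_ae_notMem.1 (Measure.addHaar_sphere volume x r)
    filter_upwards [ae_restrict_of_ae hs] with y hy
    refine Filter.Tendsto.congr' ?_ tendsto_const_nhds
    have hc : Continuous fun x' : EuclideanSpace ℝ (Fin n) => dist y x' := by fun_prop
    rcases lt_or_gt_of_ne (show dist y x ≠ r from hy) with h | h
    · filter_upwards [(hc.tendsto x).eventually_lt_const h] with x' hx'
      simp [h.le, hx'.le]
    · filter_upwards [(hc.tendsto x).eventually_const_lt h] with x' hx'
      simp [not_le.2 h, not_le.2 hx']

theorem integrableOn_mul_bounded (hg : IntegrableOn g Ω)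
    (hu : AEStronglyMeasurable u (volume.restrict Ω)) (huM : ∀ y, |u y| ≤ M) :
    IntegrableOn (fun y => g y * u y) Ω :=
  Integrable.mul_bdd (c := M) hg hu (Filter.Eventually.of_forall huM)

theorem integrableOn_indicator_mul (hg : IntegrableOn g Ω) (x : EuclideanSpace ℝ (Fin n)) :
    IntegrableOn (fun y => (closedBall x r).indicator (fun _ => (1 : ℝ)) y * g y) Ω := by
  refine Integrable.bdd_mul (c := 1) hg
    (measurable_const.indicator measurableSet_closedBall).aestronglyMeasurable
    (Filter.Eventually.of_forall fun y => ?_)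
  by_cases hy : y ∈ closedBall x r <;> simp [hy]

theorem abs_lr_sub_le (hg : IntegrableOn g Ω) (hu : AEStronglyMeasurable u (volume.restrict Ω))
    (huM : ∀ y, |u y| ≤ M) (x x' : EuclideanSpace ℝ (Fin n)) :
    |lr Ω g r u x - lr Ω g r u x'| ≤
      M * ∫ y in Ω, |(closedBall x r).indicator (fun _ => (1 : ℝ)) y -
        (closedBall x' r).indicator (fun _ => (1 : ℝ)) y| * |g y| := by
  have hgu := integrableOn_mul_bounded hg hu huM
  have hm : ∀ z : EuclideanSpace ℝ (Fin n),
      Measurable ((closedBall z r).indicator (fun _ => (1 : ℝ))) := fun z =>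
    measurable_const.indicator measurableSet_closedBall
  rw [lr_eq_setIntegral_indicator, lr_eq_setIntegral_indicator,
    ← integral_sub (integrableOn_indicator_mul hgu x) (integrableOn_indicator_mul hgu x'),
    ← integral_const_mul]
  refine (abs_integral_le_integral_abs).trans (integral_mono_of_nonneg
    (Filter.Eventually.of_forall fun _ => abs_nonneg _) ?_
    (Filter.Eventually.of_forall fun y => ?_))
  · refine Integrable.const_mul ?_ M
    refine Integrable.bdd_mul (c := 1) hg.abs
      ((hm x).sub (hm x')).abs.aestronglyMeasurable (Filter.Eventually.of_forall fun y => ?_)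
    rw [Real.norm_eq_abs, abs_abs]
    exact abs_indicator_sub_le _ _ y
  · simp only
    rw [← sub_mul, abs_mul, abs_mul, mul_comm M, mul_assoc]
    gcongr
    exact huM y

theorem continuous_lr (hn : 0 < n) (hg : IntegrableOn g Ω)
    (hu : AEStronglyMeasurable u (volume.restrict Ω)) (huM : ∀ y, |u y| ≤ M) :
    Continuous (lr Ω g r u) := by
  rw [continuous_iff_continuousAt]
  intro x
  refine tendsto_iff_dist_tendsto_zero.2 ?_
  have h1 := (tendsto_integral_abs_indicator_sub (r := r) hn hg x).const_mul M
  rw [mul_zero] at h1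
  refine squeeze_zero (fun _ => dist_nonneg) (fun x' => ?_) h1
  rw [dist_comm, Real.dist_eq]
  exact abs_lr_sub_le hg hu huM x x'

theorem abs_lr_le (hg : IntegrableOn g Ω) (huM : ∀ y, |u y| ≤ M) (x : EuclideanSpace ℝ (Fin n)) :
    |lr Ω g r u x| ≤ M * ∫ y in Ω, |g y| := by
  rw [lr_eq_setIntegral_indicator, ← integral_const_mul]
  refine (abs_integral_le_integral_abs).trans (integral_mono_of_nonneg
    (Filter.Eventually.of_forall fun _ => abs_nonneg _) (hg.abs.const_mul M)
    (Filter.Eventually.of_forall fun y => ?_))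
  by_cases hy : y ∈ closedBall x r
  · simp only [hy, indicator_of_mem, one_mul]
    rw [abs_mul, mul_comm]
    gcongr
    exact huM y
  · simp only [hy, not_false_eq_true, indicator_of_notMem, zero_mul, abs_zero]
    exact mul_nonneg ((abs_nonneg _).trans (huM y)) (abs_nonneg _)

theorem lr_sub (hgu : IntegrableOn (fun y => g y * u y) Ω)
    (hgv : IntegrableOn (fun y => g y * v y) Ω) (x : EuclideanSpace ℝ (Fin n)) :
    lr Ω g r (fun y => u y - v y) x = lr Ω g r u x - lr Ω g r v x := by
  simp only [lr, mul_sub]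
  exact integral_sub (hgu.mono_set inter_subset_left) (hgv.mono_set inter_subset_left)

theorem lr_const_mul (c : ℝ) (x : EuclideanSpace ℝ (Fin n)) :
    lr Ω g r (fun y => c * u y) x = c * lr Ω g r u x := by
  simp only [lr, mul_left_comm _ c]
  exact integral_const_mul _ _

theorem lr_mono (hg : ∀ᵐ y ∂volume.restrict Ω, 0 ≤ g y)
    (hgu : IntegrableOn (fun y => g y * u y) Ω) (hgv : IntegrableOn (fun y => g y * v y) Ω)
    (huv : ∀ y, u y ≤ v y) (x : EuclideanSpace ℝ (Fin n)) : lr Ω g r u x ≤ lr Ω g r v x := by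
  refine integral_mono_ae (hgu.mono_set inter_subset_left) (hgv.mono_set inter_subset_left) ?_
  filter_upwards [ae_restrict_of_ae_restrict_of_subset inter_subset_left hg] with y hy
  exact mul_le_mul_of_nonneg_left (huv y) hy

theorem lr_congr_ae (huv : u =ᵐ[volume.restrict Ω] v) (x : EuclideanSpace ℝ (Fin n)) :
    lr Ω g r u x = lr Ω g r v x := by
  refine integral_congr_ae ?_
  filter_upwards [ae_restrict_of_ae_restrict_of_subset inter_subset_left huv] with y hy
  rw [hy]

/-- `l_r(u)` is radial when `g` and `u` are. -/
theorem lr_eq_of_norm_eq {R : ℝ} {q : ℝ → ℝ}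
    (hgq : ∀ᵐ y ∂volume.restrict (ball (0 : EuclideanSpace ℝ (Fin n)) R), g y = q ‖y‖)
    (hu : ∀ y z, ‖y‖ = ‖z‖ → u y = u z) {x x' : EuclideanSpace ℝ (Fin n)} (hx : ‖x‖ = ‖x'‖) :
    lr (ball 0 R) g r u x = lr (ball 0 R) g r u x' := by
  have hrep : ∀ z, lr (ball 0 R) g r u z = lr (ball 0 R) (fun y => q ‖y‖) r u z := by
    intro z
    refine integral_congr_ae ?_
    filter_upwards [ae_restrict_of_ae_restrict_of_subset inter_subset_left hgq] with y hy
    rw [hy]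
  rw [hrep, hrep]
  -- This reflection takes `x` to `x'` and preserves volume, norms and the ball centred at `0`.
  set U := (Submodule.span ℝ {x - x'})ᗮ.reflection
  have hU : U x = x' := Submodule.reflection_sub hx
  have hpre : U ⁻¹' (ball 0 R ∩ closedBall x' r) = ball 0 R ∩ closedBall x r := by
    ext y
    simp only [mem_preimage, mem_inter_iff, mem_ball_zero_iff, LinearIsometryEquiv.norm_map,
      mem_closedBall, ← hU, LinearIsometryEquiv.dist_map]
  have h1 := U.measurePreserving.setIntegral_preimage_emb U.toHomeomorph.measurableEmbedding
    (fun y => q ‖y‖ * u y) (ball 0 R ∩ closedBall x' r)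
  simp only [lr]
  rw [← h1, hpre]
  refine setIntegral_congr_fun (measurableSet_ball.inter measurableSet_closedBall) fun y _ => ?_
  simp only [LinearIsometryEquiv.norm_map]
  rw [hu y (U y) (LinearIsometryEquiv.norm_map U y).symm]

end Nonlocal

end NonlocalRadial

/-! ### The fixed point problem for the profile -/

/-- Schauder's theorem in an order interval of `C(X, ℝ)`, compactness being provided by the
Arzelà–Ascoli theorem. -/
theorem ContinuousMap.exists_fixedPoint_of_equicontinuousAt {X : Type*} [MetricSpace X]
    [CompactSpace X] {m₀ m₁ : ℝ} (hm : m₀ ≤ m₁) {T : C(X, ℝ) → C(X, ℝ)} (hT : Continuous T)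
    (hmaps : ∀ H : C(X, ℝ), (∀ x, H x ∈ Icc m₀ m₁) → ∀ x, T H x ∈ Icc m₀ m₁)
    (hequi : ∀ x₀, EquicontinuousAt
      (fun H : {H : C(X, ℝ) // ∀ x, H x ∈ Icc m₀ m₁} => (T H : X → ℝ)) x₀) :
    ∃ H : C(X, ℝ), (∀ x, H x ∈ Icc m₀ m₁) ∧ T H = H := by
  set K : Set C(X, ℝ) := {H | ∀ x, H x ∈ Icc m₀ m₁} with hK
  have hconv : Convex ℝ K := by
    intro F hF G hG s t hs ht hst x
    exact convex_Icc m₀ m₁ (hF x) (hG x) hs ht hst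
  have hcl : IsClosed K := by
    have : K = ⋂ x, (fun H : C(X, ℝ) => H x) ⁻¹' Icc m₀ m₁ := by
      ext H; simp [hK]
    rw [this]
    exact isClosed_iInter fun x => isClosed_Icc.preimage (continuous_eval_const x)
  have hne : K.Nonempty := ⟨ContinuousMap.const X m₀, fun _ => ⟨le_rfl, hm⟩⟩
  set Φ := ContinuousMap.isometryEquivBoundedOfCompact X ℝ
  set A : Set (BoundedContinuousFunction X ℝ) := (fun H => Φ (T H)) '' K with hA
  have hcomp : IsCompact (closure A) := by
    refine BoundedContinuousFunction.arzela_ascoli (Icc m₀ m₁) isCompact_Icc A ?_ ?_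
    · rintro _ x ⟨H, hH, rfl⟩
      exact hmaps H hH x
    · intro x₀ U hU
      filter_upwards [hequi x₀ U hU] with x hx
      rintro ⟨_, H, hH, rfl⟩
      exact hx ⟨H, hH⟩
  obtain ⟨H, hH, hfix⟩ := hT.continuousOn.exists_fixedPoint_of_subset_isCompact hconv hcl hne
    (fun H hH => hmaps H hH) (hcomp.image Φ.symm.continuous) (fun H hH =>
      ⟨Φ (T H), subset_closure ⟨H, hH, rfl⟩, Φ.symm_apply_apply _⟩)
  exact ⟨H, hH, hfix⟩

namespace NonlocalRadial

section FixedPoint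

variable {n : ℕ} {R r : ℝ} {g : EuclideanSpace ℝ (Fin n) → ℝ} {w : ℝ → ℝ}

/-- The radial potential of `c w`, with `c` extended by constants outside `[0, R]`. -/
noncomputable def weightedPotential (hR : 0 ≤ R) (w : ℝ → ℝ) (c : C(Icc 0 R, ℝ)) :
    EuclideanSpace ℝ (Fin n) → ℝ :=
  radialPotential R fun s => IccExtend hR c s * w s

theorem abs_IccExtend_le (hR : 0 ≤ R) (c : C(Icc 0 R, ℝ)) (s : ℝ) : |IccExtend hR c s| ≤ ‖c‖ :=
  c.norm_coe_le_norm _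

theorem memLp_IccExtend_mul (hR : 0 ≤ R) (hw : MemLp w 2 (volume.restrict (Ioo 0 R)))
    (c : C(Icc 0 R, ℝ)) :
    MemLp (fun s => IccExtend hR c s * w s) 2 (volume.restrict (Ioo 0 R)) := by
  have hc : Continuous (IccExtend hR c) := c.continuous.Icc_extend'
  refine MemLp.of_le_mul (c := ‖c‖) hw (hc.aestronglyMeasurable.mul hw.1)
    (Filter.Eventually.of_forall fun s => ?_)
  rw [norm_mul]
  exact mul_le_mul_of_nonneg_right (abs_IccExtend_le hR c s) (norm_nonneg _)

theorem integrableOn_IccExtend_mul (hR : 0 ≤ R) (hw : MemLp w 2 (volume.restrict (Ioo 0 R)))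
    (c : C(Icc 0 R, ℝ)) : IntegrableOn (fun s => IccExtend hR c s * w s) (Ioo 0 R) :=
  integrableOn_Ioo_of_memLp_two (memLp_IccExtend_mul hR hw c)

theorem abs_weightedPotential_le (hR : 0 ≤ R) (hw : MemLp w 2 (volume.restrict (Ioo 0 R)))
    (c : C(Icc 0 R, ℝ)) (x : EuclideanSpace ℝ (Fin n)) :
    |weightedPotential hR w c x| ≤ ‖c‖ * ∫ t in Ioo 0 R, |w t| := by
  refine (abs_radialPotential_le (integrableOn_IccExtend_mul hR hw c) x).trans ?_
  rw [← integral_const_mul]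
  refine integral_mono_of_nonneg (Filter.Eventually.of_forall fun _ => abs_nonneg _)
    ((integrableOn_Ioo_of_memLp_two hw).abs.const_mul _) (Filter.Eventually.of_forall fun s => ?_)
  simp only [abs_mul]
  exact mul_le_mul_of_nonneg_right (abs_IccExtend_le hR c s) (abs_nonneg _)

theorem continuous_weightedPotential (hR : 0 ≤ R) (hw : MemLp w 2 (volume.restrict (Ioo 0 R)))
    (c : C(Icc 0 R, ℝ)) : Continuous (weightedPotential (n := n) hR w c) :=
  continuous_radialPotential (integrableOn_IccExtend_mul hR hw c)

theorem weightedPotential_sub (hR : 0 ≤ R) (hw : MemLp w 2 (volume.restrict (Ioo 0 R)))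
    (c c' : C(Icc 0 R, ℝ)) (x : EuclideanSpace ℝ (Fin n)) :
    weightedPotential hR w (c - c') x =
      weightedPotential hR w c x - weightedPotential hR w c' x := by
  rw [weightedPotential, weightedPotential, weightedPotential,
    ← radialPotential_sub (integrableOn_IccExtend_mul hR hw c)
      (integrableOn_IccExtend_mul hR hw c')]
  congr 1
  ext s
  simp [IccExtend, sub_mul]

theorem radialPotential_const_mul (k : ℝ) (θ : ℝ → ℝ) (x : EuclideanSpace ℝ (Fin n)) :
    radialPotential R (fun s => k * θ s) x = k * radialPotential R θ x :=
  integral_const_mul _ _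

theorem radialPotential_mono {θ η : ℝ → ℝ} (hθ : IntegrableOn θ (Ioo 0 R))
    (hη : IntegrableOn η (Ioo 0 R)) (h : ∀ s ∈ Ioo 0 R, θ s ≤ η s)
    (x : EuclideanSpace ℝ (Fin n)) : radialPotential R θ x ≤ radialPotential R η x :=
  setIntegral_mono_on (hθ.mono_set (Ioo_norm_subset x)) (hη.mono_set (Ioo_norm_subset x))
    measurableSet_Ioo fun s hs => h s (Ioo_norm_subset x hs)

/-- Existence of a profile `H = l_r(u)`, `u` being the potential of `w / a(H)`. -/
theorem exists_profile (hn : 0 < n) (hR : 0 ≤ R) (hg : IntegrableOn g (ball 0 R))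
    (hw : MemLp w 2 (volume.restrict (Ioo 0 R))) {a : ℝ → ℝ} (ha : Continuous a)
    (ha0 : ∀ t, a t ≠ 0) {m₀ m₁ : ℝ} (hm : m₀ ≤ m₁) (e : EuclideanSpace ℝ (Fin n))
    (hmaps : ∀ c : C(Icc 0 R, ℝ), (∀ ρ, ∃ t ∈ Icc m₀ m₁, c ρ = (a t)⁻¹) → ∀ ρ : Icc 0 R,
      lr (ball 0 R) g r (weightedPotential hR w c) ((ρ : ℝ) • e) ∈ Icc m₀ m₁) :
    ∃ H c : C(Icc 0 R, ℝ), (∀ ρ, H ρ ∈ Icc m₀ m₁) ∧ (∀ ρ, c ρ = (a (H ρ))⁻¹) ∧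
      ∀ ρ : Icc 0 R, lr (ball 0 R) g r (weightedPotential hR w c) ((ρ : ℝ) • e) = H ρ := by
  set Ω : Set (EuclideanSpace ℝ (Fin n)) := ball 0 R
  set W : ℝ := ∫ t in Ioo 0 R, |w t| with hW
  have hW0 : 0 ≤ W := integral_nonneg fun _ => abs_nonneg _
  have hum : ∀ c : C(Icc 0 R, ℝ), AEStronglyMeasurable (weightedPotential (n := n) hR w c)
      (volume.restrict Ω) := fun c =>
    (continuous_weightedPotential hR hw c).aestronglyMeasurable
  have hub := fun (c : C(Icc 0 R, ℝ)) => abs_weightedPotential_le (n := n) hR hw c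
  have hρ : Continuous fun ρ : Icc 0 R => (ρ : ℝ) • e := by fun_prop
  -- `l_r` is recorded only along the ray through `e`, which keeps the unknown in `C([0, R])`. `L`
  -- respects differences, so the sup bound on `l_r` makes it Lipschitz.
  set L : C(Icc 0 R, ℝ) → C(Icc 0 R, ℝ) := fun c =>
    ⟨fun ρ => lr Ω g r (weightedPotential hR w c) ((ρ : ℝ) • e),
      (continuous_lr hn hg (hum c) (hub c)).comp hρ⟩ with hL
  have hLlip : LipschitzWith (Real.toNNReal (W * ∫ y in Ω, |g y|)) L := by
    refine LipschitzWith.of_dist_le_mul fun c c' => ?_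
    have hk : 0 ≤ W * ∫ y in Ω, |g y| := mul_nonneg hW0 (integral_nonneg fun _ => abs_nonneg _)
    rw [Real.coe_toNNReal _ hk, ContinuousMap.dist_le (mul_nonneg hk dist_nonneg)]
    intro ρ
    rw [Real.dist_eq]
    simp only [hL, ContinuousMap.coe_mk]
    rw [← lr_sub (integrableOn_mul_bounded hg (hum c) (hub c))
      (integrableOn_mul_bounded hg (hum c') (hub c'))]
    simp only [← weightedPotential_sub hR hw]
    refine (abs_lr_le hg (hub (c - c')) _).trans (le_of_eq ?_)
    rw [dist_eq_norm]
    ring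
  set b : C(ℝ, ℝ) := ⟨fun t => (a t)⁻¹, ha.inv₀ ha0⟩
  have hTc : Continuous fun H : C(Icc 0 R, ℝ) => L (b.comp H) :=
    hLlip.continuous.comp (ContinuousMap.continuous_postcomp b)
  obtain ⟨B, hB⟩ : ∃ B : ℝ, ∀ t ∈ Icc m₀ m₁, |b t| ≤ B := by
    obtain ⟨B, hB⟩ := (isCompact_Icc (a := m₀) (b := m₁)).exists_bound_of_continuousOn
      b.continuous.continuousOn
    exact ⟨B, hB⟩
  have hB0 : 0 ≤ B := (abs_nonneg _).trans (hB m₀ ⟨le_rfl, hm⟩)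
  obtain ⟨H, hH, hfix⟩ := ContinuousMap.exists_fixedPoint_of_equicontinuousAt hm hTc
    (fun H hH => hmaps _ fun ρ => ⟨H ρ, hH ρ, rfl⟩) (fun ρ₀ => by
      -- `B` bounds `1/a` on `[m₀, m₁]`, so all the potentials involved are bounded by `B * W` and
      -- share one modulus.
      refine Metric.equicontinuousAt_of_continuity_modulus (fun ρ : Icc 0 R => (B * W) *
        ∫ y in Ω, |(closedBall ((ρ₀ : ℝ) • e) r).indicator (fun _ => (1 : ℝ)) y -
          (closedBall ((ρ : ℝ) • e) r).indicator (fun _ => (1 : ℝ)) y| * |g y|) ?_ _ ?_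
      · have h1 := ((tendsto_integral_abs_indicator_sub (r := r) hn hg ((ρ₀ : ℝ) • e)).comp
          (hρ.tendsto ρ₀)).const_mul (B * W)
        rw [mul_zero] at h1
        exact h1
      · refine Filter.Eventually.of_forall fun ρ H => ?_
        rw [Real.dist_eq]
        refine (abs_lr_sub_le hg (hum _) (hub _) _ _).trans ?_
        have hn : ‖b.comp (H : C(Icc 0 R, ℝ))‖ ≤ B :=
          (ContinuousMap.norm_le _ hB0).2 fun ρ' => hB _ (H.2 ρ')
        gcongr)
  exact ⟨H, b.comp H, hH, fun _ => rfl, fun ρ => DFunLike.congr_fun hfix ρ⟩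

/-- If `l_r` of the potential of `w` lies between `m₀ a(m₀)` and `m₁ a(m₁)`, some potential `u` of
`w / a(l_r(u))` satisfies `m₀ ≤ l_r(u) ≤ m₁`. -/
theorem exists_weightedPotential (hn : 0 < n) (hR : 0 ≤ R) (hg : IntegrableOn g (ball 0 R))
    (hg0 : ∀ᵐ y ∂volume.restrict (ball 0 R), 0 ≤ g y) {q : ℝ → ℝ}
    (hgq : ∀ᵐ y ∂volume.restrict (ball (0 : EuclideanSpace ℝ (Fin n)) R), g y = q ‖y‖)
    (hw : MemLp w 2 (volume.restrict (Ioo 0 R))) (hw0 : ∀ s ∈ Ioo 0 R, 0 ≤ w s)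
    {a : ℝ → ℝ} (ha : Continuous a) (ha0 : ∀ t, 0 < a t) {m₀ m₁ : ℝ} (hm : m₀ ≤ m₁)
    (hmax : IsMaxOn a (Icc m₀ m₁) m₀) (hmin : IsMinOn a (Icc m₀ m₁) m₁)
    (hlr : ∀ x ∈ closedBall (0 : EuclideanSpace ℝ (Fin n)) R,
      lr (ball 0 R) g r (radialPotential R w) x ∈ Icc (m₀ * a m₀) (m₁ * a m₁)) :
    ∃ θ : ℝ → ℝ, MemLp θ 2 (volume.restrict (Ioo 0 R)) ∧
      ∀ x ∈ ball (0 : EuclideanSpace ℝ (Fin n)) R,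
        lr (ball 0 R) g r (radialPotential R θ) x ∈ Icc m₀ m₁ ∧
        a (lr (ball 0 R) g r (radialPotential R θ) x) * θ ‖x‖ = w ‖x‖ := by
  set i : Fin n := ⟨0, hn⟩
  set e : EuclideanSpace ℝ (Fin n) := EuclideanSpace.single i 1 with he
  have hen : ‖e‖ = 1 := by simp [he]
  have hnorm : ∀ ρ : Icc 0 R, ‖(ρ : ℝ) • e‖ = ρ := fun ρ => by
    rw [norm_smul, hen, mul_one, Real.norm_eq_abs, abs_of_nonneg ρ.2.1]
  have hwi := integrableOn_Ioo_of_memLp_two hw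
  have hint : ∀ θ : ℝ → ℝ, IntegrableOn θ (Ioo 0 R) →
      IntegrableOn (fun y => g y * radialPotential R θ y) (ball 0 R) := fun θ hθ =>
    integrableOn_mul_bounded hg (continuous_radialPotential hθ).aestronglyMeasurable
      (abs_radialPotential_le hθ)
  obtain ⟨H, c, hH, hc, hfix⟩ := exists_profile (r := r) hn hR hg hw ha (fun t => (ha0 t).ne') hm e
    (by
      intro c hc ρ
      have hmem : (ρ : ℝ) • e ∈ closedBall (0 : EuclideanSpace ℝ (Fin n)) R := by
        rw [mem_closedBall_zero_iff, hnorm]; exact ρ.2.2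
      have hci := integrableOn_IccExtend_mul hR hw c
      have hcb : ∀ s, (a m₀)⁻¹ ≤ IccExtend hR c s ∧ IccExtend hR c s ≤ (a m₁)⁻¹ := by
        intro s
        obtain ⟨t, ht, hct⟩ := hc (projIcc 0 R hR s)
        have h1 : IccExtend hR c s = (a t)⁻¹ := hct
        rw [h1]
        exact ⟨inv_anti₀ (ha0 t) (hmax ht), inv_anti₀ (ha0 m₁) (hmin ht)⟩
      have hlow : ∀ k : ℝ, lr (ball 0 R) g r (radialPotential R fun s => k * w s) ((ρ : ℝ) • e)
          = k * lr (ball 0 R) g r (radialPotential R w) ((ρ : ℝ) • e) := by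
        intro k
        rw [← lr_const_mul]
        congr 1
        ext y
        exact radialPotential_const_mul k w y
      obtain ⟨h1, h2⟩ := hlr _ hmem
      -- Monotonicity of the potential (`w ≥ 0`) and of `l_r` (`g ≥ 0`) compares with the constant
      -- coefficients `(a m₀)⁻¹` and `(a m₁)⁻¹`, for which `l_r` is a multiple of that of the
      -- potential of `w`.
      constructor
      · have h3 := lr_mono (r := r) hg0 (hint _ (hwi.const_mul (a m₀)⁻¹)) (hint _ hci)
          (radialPotential_mono (hwi.const_mul _) hci fun s hs =>
            mul_le_mul_of_nonneg_right (hcb s).1 (hw0 s hs)) ((ρ : ℝ) • e)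
        rw [hlow] at h3
        refine le_trans ?_ h3
        rw [← div_eq_inv_mul, le_div_iff₀ (ha0 m₀)]
        exact h1
      · have h3 := lr_mono (r := r) hg0 (hint _ hci) (hint _ (hwi.const_mul (a m₁)⁻¹))
          (radialPotential_mono hci (hwi.const_mul _) fun s hs =>
            mul_le_mul_of_nonneg_right (hcb s).2 (hw0 s hs)) ((ρ : ℝ) • e)
        rw [hlow] at h3
        refine h3.trans ?_
        rw [← div_eq_inv_mul, div_le_iff₀ (ha0 m₁)]
        exact h2)
  refine ⟨fun s => IccExtend hR c s * w s, memLp_IccExtend_mul hR hw c, fun x hx => ?_⟩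
  have hx' : ‖x‖ ∈ Icc 0 R := ⟨norm_nonneg x, (mem_ball_zero_iff.1 hx).le⟩
  have hlrx : lr (ball 0 R) g r (radialPotential R fun s => IccExtend hR c s * w s) x
      = H ⟨‖x‖, hx'⟩ := by
    rw [← hfix ⟨‖x‖, hx'⟩]
    -- By radial symmetry the value at `x` is the value at `‖x‖ • e`, where `H` was prescribed.
    refine lr_eq_of_norm_eq hgq (fun y z hyz => ?_) (hnorm ⟨‖x‖, hx'⟩).symm
    rw [radialPotential, radialPotential, hyz]
  rw [hlrx]
  refine ⟨hH _, ?_⟩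
  simp only
  rw [IccExtend_of_mem hR c hx', hc, mul_inv_cancel_left₀ (ha0 _).ne']

end FixedPoint

/-! ### Construction of the distinct radial solutions -/

theorem memRadialL2_radialPotential {n : ℕ} {d : ℝ} {θ : ℝ → ℝ}
    (hθ : IntegrableOn θ (Ioo 0 (d / 2))) :
    MemRadialL2 d (radialPotential (n := n) (d / 2) θ) := by
  have : IsFiniteMeasure (volume.restrict (ball (0 : EuclideanSpace ℝ (Fin n)) (d / 2))) := ⟨by
    rw [Measure.restrict_apply_univ]; exact measure_ball_lt_top⟩
  refine ⟨MemLp.of_bound (continuous_radialPotential hθ).aestronglyMeasurable _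
    (Filter.Eventually.of_forall (abs_radialPotential_le hθ)),
    fun s => ∫ t in Ioo (max s 0) (d / 2), θ t, ?_, Filter.Eventually.of_forall fun x => ?_⟩
  · refine MemLp.of_bound (continuous_integral_Ioo_right hθ).aestronglyMeasurable _
      (Filter.Eventually.of_forall fun s => abs_setIntegral_le_of_subset hθ ?_)
    exact Ioo_subset_Ioo_left (le_max_right _ _)
  · simp only [max_eq_left (norm_nonneg x), radialPotential]

end NonlocalRadial

theorem proposition3p4 (n : ℕ) (hn : 0 < n) (d : ℝ) (hd : 0 < d) (r : ℝ) (hr : r ∈ Icc 0 d)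
    (Ω : Set (EuclideanSpace ℝ (Fin n))) (hΩ : Ω = ball 0 (d / 2))
    (f g : EuclideanSpace ℝ (Fin n) → ℝ) (a : ℝ → ℝ)
    (hf : NonlocalRadial.MemRadialL2 d f) (hg : NonlocalRadial.MemRadialL2 d g)
    -- `a` is the continuous representative of its class in `W^{1,∞}(ℝ)`
    (ha_cont : Continuous a) (ha : NonlocalRadial.MemW1Infty a) (ha_pos : 0 < ⨅ t, a t)
    (hf_nonneg : ∀ᵐ x ∂(volume.restrict Ω), 0 ≤ f x)
    (hg_nonneg : ∀ᵐ x ∂(volume.restrict Ω), 0 ≤ g x)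
    -- `φ` is the solution of `-Δφ = f`, `φ ∈ H¹₀(Ω)`
    (φ : EuclideanSpace ℝ (Fin n) → ℝ)
    (hφ : NonlocalRadial.IsWeakSolution Ω (fun _ => 1) f φ)
    (n₁ : ℕ) (hn₁ : Odd n₁) (m : ℕ → ℝ) (hm_zero : m 0 = 0)
    (hm_lt : ∀ i < n₁, m i < m (i + 1))
    (ha_max : ∀ i < n₁, Even i → IsMaxOn a (Icc (m i) (m (i + 1))) (m i))
    (ha_min : ∀ i < n₁, Even i → IsMinOn a (Icc (m i) (m (i + 1))) (m (i + 1)))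
    (hI : NonlocalRadial.intervalIr Ω g r φ ⊆
      ⋂ i ∈ {i : ℕ | i < n₁ ∧ Even i}, Icc (m i * a (m i)) (m (i + 1) * a (m (i + 1)))) :
    -- `u k` is the solution with the even index `i = 2 k` in `{0, 2, …, n₁ - 1}`
    ∃ u : Fin ((n₁ + 1) / 2) → EuclideanSpace ℝ (Fin n) → ℝ,
      (∀ k, NonlocalRadial.IsSolutionPr Ω a f g r (u k) ∧ NonlocalRadial.MemRadialL2 d (u k) ∧
        ∀ x ∈ Ω, m (2 * k) ≤ NonlocalRadial.lr Ω g r (u k) x ∧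
          NonlocalRadial.lr Ω g r (u k) x ≤ m (2 * k + 1)) ∧
      Pairwise fun j k => ¬ (u j =ᵐ[volume.restrict Ω] u k) := by
  open NonlocalRadial in
  subst hΩ
  set R := d / 2 with hR_def
  have hR : 0 < R := half_pos hd
  have hfin : IsFiniteMeasure (volume.restrict (ball (0 : EuclideanSpace ℝ (Fin n)) R)) := ⟨by
    rw [Measure.restrict_apply_univ]; exact measure_ball_lt_top⟩
  -- The real infimum of a set unbounded below is `0` by convention, so its positivity also forces
  -- `a` to be bounded below.
  have ha0 : ∀ t, 0 < a t := by
    have hbdd : BddBelow (range a) := by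
      by_contra h
      rw [Real.iInf_of_not_bddBelow h] at ha_pos
      exact lt_irrefl _ ha_pos
    exact fun t => ha_pos.trans_le (ciInf_le hbdd t)
  obtain ⟨hgL, q, -, hgq⟩ := hg
  have hgi : IntegrableOn g (ball 0 R) := hgL.integrable one_le_two
  obtain ⟨hfL, p₀, hp₀, hfp₀⟩ := hf
  -- Taking the positive part leaves the a.e. identity with `f ≥ 0` intact and makes the flux
  -- nonnegative at every radius.
  set p : ℝ → ℝ := fun s => max (p₀ s) 0 with hp_def
  have hp : MemLp p 2 (volume.restrict (Ioo 0 R)) :=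
    MemLp.of_le hp₀ (hp₀.1.sup aestronglyMeasurable_const)
      (Filter.Eventually.of_forall fun s => by
        rw [Real.norm_eq_abs, Real.norm_eq_abs, abs_of_nonneg (le_max_right _ _)]
        exact max_le (le_abs_self _) (abs_nonneg _))
  have hfp : ∀ᵐ x ∂volume.restrict (ball (0 : EuclideanSpace ℝ (Fin n)) R), f x = p ‖x‖ := by
    filter_upwards [hfp₀, hf_nonneg] with x h1 h2
    rw [hp_def]
    simp only
    rw [← h1, max_eq_left h2]
  have hpi := integrableOn_Ioo_of_memLp_two hp
  set w : ℝ → ℝ := radialFlux n p with hw_def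
  have hw : MemLp w 2 (volume.restrict (Ioo 0 R)) := memLp_radialFlux n hpi
  have hwi := integrableOn_Ioo_of_memLp_two hw
  have hw0 : ∀ s ∈ Ioo 0 R, 0 ≤ w s := fun s hs =>
    radialFlux_nonneg n (fun _ => le_max_right _ _) hs.1.le
  have hφw : φ =ᵐ[volume.restrict (ball 0 R)] radialPotential R w :=
    hφ.ae_eq_of_ball hn hR.le
      (isWeakSolution_radialPotential hn hR hp hw hfL hfp fun x _ => one_mul _)
  have hbound := abs_radialPotential_le (n := n) hwi
  have hlrc : Continuous (lr (ball 0 R) g r (radialPotential R w)) :=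
    continuous_lr hn hgi (continuous_radialPotential hwi).aestronglyMeasurable hbound
  have hlrI : ∀ x ∈ ball (0 : EuclideanSpace ℝ (Fin n)) R,
      lr (ball 0 R) g r (radialPotential R w) x ∈ intervalIr (ball 0 R) g r φ := by
    intro x hx
    have hmem : lr (ball 0 R) g r (radialPotential R w) x ∈ lr (ball 0 R) g r φ '' ball 0 R :=
      ⟨x, hx, lr_congr_ae hφw x⟩
    have hb : ∀ y ∈ lr (ball 0 R) g r φ '' ball 0 R,
        |y| ≤ (∫ t in Ioo 0 R, |w t|) * ∫ y in ball 0 R, |g y| := by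
      rintro _ ⟨z, -, rfl⟩
      rw [lr_congr_ae hφw z]
      exact abs_lr_le hgi hbound z
    exact ⟨csInf_le ⟨_, fun y hy => neg_le_of_abs_le (hb y hy)⟩ hmem,
      le_csSup ⟨_, fun y hy => le_of_abs_le (hb y hy)⟩ hmem⟩
  -- Oddness of `n₁` makes the division exact, so `2 k` runs through `0, 2, …, n₁ - 1`.
  have hidx : ∀ k : Fin ((n₁ + 1) / 2), 2 * (k : ℕ) < n₁ := by
    intro k
    obtain ⟨l, hl⟩ := hn₁
    have := k.2
    omega
  have hex : ∀ k : Fin ((n₁ + 1) / 2), ∃ θ : ℝ → ℝ, MemLp θ 2 (volume.restrict (Ioo 0 R)) ∧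
      ∀ x ∈ ball (0 : EuclideanSpace ℝ (Fin n)) R,
        lr (ball 0 R) g r (radialPotential R θ) x ∈ Icc (m (2 * k)) (m (2 * k + 1)) ∧
        a (lr (ball 0 R) g r (radialPotential R θ) x) * θ ‖x‖ = w ‖x‖ := by
    intro k
    refine exists_weightedPotential hn hR.le hgi hg_nonneg hgq hw hw0 ha_cont ha0
      (hm_lt _ (hidx k)).le (ha_max _ (hidx k) (even_two_mul _))
      (ha_min _ (hidx k) (even_two_mul _)) fun x hx => ?_
    -- `I_r` only controls the open ball, whereas profiles live on all of `[0, R]`; continuity of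
    -- `l_r` reaches the boundary.
    rw [← closure_ball (0 : EuclideanSpace ℝ (Fin n)) hR.ne'] at hx
    refine closure_minimal (fun y hy => ?_) (isClosed_Icc.preimage hlrc) hx
    exact mem_iInter₂.1 (hI (hlrI y hy)) (2 * k) ⟨hidx k, even_two_mul _⟩
  choose θ hθ hlrθ using hex
  refine ⟨fun k => radialPotential R (θ k), fun k => ⟨?_, ?_, fun x hx => (hlrθ k x hx).1⟩, ?_⟩
  · exact isWeakSolution_radialPotential hn hR hp (hθ k) hfL hfp fun x hx => (hlrθ k x hx).2
  · exact memRadialL2_radialPotential (integrableOn_Ioo_of_memLp_two (hθ k))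
  · have hmono : ∀ j l : ℕ, l ≤ n₁ → j < l → m j < m l := by
      intro j l hl hjl
      induction l, hjl using Nat.le_induction with
      | base => exact hm_lt j (by omega)
      | succ l hjl ih => exact (ih (by omega)).trans (hm_lt l (by omega))
    have hsep : ∀ j k : Fin ((n₁ + 1) / 2), j < k →
        ¬ radialPotential (n := n) R (θ j) =ᵐ[volume.restrict (ball 0 R)]
          radialPotential R (θ k) := by
      intro j k hjk hae
      have h0 : (0 : EuclideanSpace ℝ (Fin n)) ∈ ball (0 : EuclideanSpace ℝ (Fin n)) R :=
        mem_ball_self hR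
      -- The bounds on `l_r` hold pointwise and `l_r` ignores null sets, so a.e. equal potentials
      -- would give `m (2k) ≤ m (2j + 1)` at the centre, against `2j + 1 < 2k`.
      have h1 := (hlrθ j 0 h0).1.2
      have h2 := (hlrθ k 0 h0).1.1
      rw [lr_congr_ae hae] at h1
      have hjk' : (j : ℕ) < k := hjk
      have h3 := hmono (2 * j + 1) (2 * k) (hidx k).le (by omega)
      linarith
    intro j k hjk hae
    rcases lt_or_gt_of_ne hjk with h | h
    · exact hsep j k h hae
    · exact hsep k j h hae.symm
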